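/- Let $\tau\in(2,3)$ and let $D$ be an $\mathbb N$-valued random variable with $\mathbb P(D\ge 2)=1$ and, for some constants $0<c_1\le C_1<\infty$, $$\frac{c_1}{x^{\tau-1}}\le \mathbb P(D>x)\le \frac{C_1}{x^{\tau-1}}\qquad\text{for all } x\ge 1 .$$ Let $D^\star$ have the law $\mathbb P(D^\star=j)=(j+1)\,\mathbb P(D=j+1)/\mathbb E[D]$, $j\ge 0$. Consider the Galton–Watson tree in which the root has $D$ children and every other individual has a number of children distributed as $D^\star$, all independent; the degree of an individual is its number of children. Let $Z_k$ be the size of generation $k$, and let $Y=\lim_{k\to\infty}(\tau-2)^k\log Z_k$ (an almost sure limit). Assume that the law of $Y$ is absolutely continuous (with respect to Lebesgue measure) and that its support contains an interval $(0,K)$ for some $K>0$. For $Q>1$ let $\kappa$ be the first generation that contains an individual of degree at least $Q$; the tree is stopped at generation $\kappa$. Fix $\gamma\in(1,1/(\tau-2))$. Starting rule: every individual of generation $\kappa$ is painted red if its degree is in $[Q,Q^\gamma)$, is painted red or blue with probability $1/2$ each if its degree is in $[Q^\gamma,Q^{1/(\tau-2)})$, and is left uncoloured otherwise. Flow rule: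 successively for generations $\kappa-1,\kappa-2,\dots,0$, an individual that has both red and blue children is painted red or blue with probability $1/2$ each; an individual whose coloured children all have the same colour takes that colour; an individual without coloured children stays uncoloured. All the coin flips are independent of each other and of the tree. Then for every $\gamma\in(1,1/(\tau-2))$ there are constants $0<c(\gamma)\le C(\gamma)<1$ such that $$c(\gamma)\le\liminf_{Q\to\infty}\mathbb P(\text{root is painted blue})\le\limsup_{Q\to\infty}\mathbb P(\text{root is painted blue})\le C(\gamma),$$ and these can be chosen so that $C(\gamma)$ is non-increasing in $\gamma$ and $C(\gamma)\to 0$ as $\gamma\nearrow 1/(\tau-2)$. -/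

import Mathlib

open MeasureTheory Set Filter
open scoped ENNReal Topology

noncomputable section

/-- A degree distribution `D` on `ℕ` with `ℙ(D ≥ 2) = 1` and power-law tail exponent `τ ∈ (2,3)`:
`c₁ / x^(τ-1) ≤ ℙ(D > x) ≤ C₁ / x^(τ-1)` for all real `x ≥ 1`. -/
structure DegreeLaw (τ : ℝ) where
  /-- The law of `D`. -/
  pmf : PMF ℕ
  two_lt : 2 < τ
  lt_three : τ < 3
  zero_eq : pmf 0 = 0
  one_eq : pmf 1 = 0
  tail_lower : ∃ c₁ : ℝ, 0 < c₁ ∧ ∀ x : ℝ, 1 ≤ x →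
    c₁ / x ^ (τ - 1) ≤ pmf.toMeasure.real {k : ℕ | x < (k : ℝ)}
  tail_upper : ∃ C₁ : ℝ, 0 < C₁ ∧ ∀ x : ℝ, 1 ≤ x →
    pmf.toMeasure.real {k : ℕ | x < (k : ℝ)} ≤ C₁ / x ^ (τ - 1)

namespace DegreeLaw

variable {τ : ℝ} (L : DegreeLaw τ)

/-- The mean `𝔼[D]`. -/
def mean : ℝ≥0∞ := ∑' k : ℕ, (k : ℝ≥0∞) * L.pmf k

theorem mean_eq : L.mean = ∑' j : ℕ, ((j : ℝ≥0∞) + 1) * L.pmf (j + 1) := by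
  unfold mean
  rw [tsum_eq_zero_add' ENNReal.summable]
  simp

theorem mean_ne_zero : L.mean ≠ 0 := by
  intro h
  have h2 : ∀ k : ℕ, (k : ℝ≥0∞) * L.pmf k = 0 := ENNReal.tsum_eq_zero.mp h
  have h3 : ∀ k : ℕ, L.pmf k = 0 := by
    intro k
    rcases Nat.eq_zero_or_pos k with rfl | hk
    · exact L.zero_eq
    · rcases mul_eq_zero.mp (h2 k) with h4 | h4
      · exact absurd (by exact_mod_cast h4) hk.ne'
      · exact h4
  have h5 := L.pmf.tsum_coe
  simp [h3] at h5

theorem mean_ne_top : L.mean ≠ ⊤ := by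
  obtain ⟨C, hC, hub⟩ := L.tail_upper
  have hτ := L.two_lt
  have e : L.mean = ∑' n : ℕ, L.pmf.toMeasure {k : ℕ | n < k} := by
    have h1 : ∀ k : ℕ, (k : ℝ≥0∞) * L.pmf k = ∑' n : ℕ, if n < k then L.pmf k else 0 := by
      intro k
      rw [tsum_eq_sum (s := Finset.range k) (fun n hn => if_neg (by simpa using hn))]
      rw [Finset.sum_congr rfl (fun n hn => if_pos (by simpa using hn))]
      simp
    unfold mean
    rw [tsum_congr h1, ENNReal.tsum_comm]
    refine tsum_congr fun n => ?_
    rw [PMF.toMeasure_apply L.pmf (MeasurableSet.of_discrete)]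
    refine tsum_congr fun k => ?_
    simp [Set.indicator_apply]
  rw [e, tsum_eq_zero_add' ENNReal.summable]
  have hb : ∀ n : ℕ, L.pmf.toMeasure {k : ℕ | n + 1 < k}
      ≤ ENNReal.ofReal (C / ((n + 1 : ℕ) : ℝ) ^ (τ - 1)) := by
    intro n
    have h := hub ((n + 1 : ℕ) : ℝ) (by push_cast; linarith [n.cast_nonneg (α := ℝ)])
    rw [show {k : ℕ | (((n + 1 : ℕ) : ℝ)) < (k : ℝ)} = {k : ℕ | n + 1 < k} by
      ext k; simp only [Set.mem_ofPred_eq, Nat.cast_lt]] at h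
    rw [← ENNReal.ofReal_toReal (measure_ne_top L.pmf.toMeasure {k : ℕ | n + 1 < k})]
    exact ENNReal.ofReal_le_ofReal h
  have hs : Summable fun n : ℕ => C / ((n + 1 : ℕ) : ℝ) ^ (τ - 1) := by
    have h0 := (Real.summable_one_div_nat_rpow (p := τ - 1)).mpr (by linarith)
    have h1 := ((summable_nat_add_iff 1).mpr h0).mul_left C
    simpa [div_eq_mul_inv] using h1
  refine ENNReal.add_ne_top.mpr ⟨measure_ne_top _ _, ?_⟩
  refine ne_top_of_le_ne_top ?_ (ENNReal.tsum_le_tsum hb)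
  rw [← ENNReal.ofReal_tsum_of_nonneg (fun n => by positivity) hs]
  exact ENNReal.ofReal_ne_top

/-- The law of `D⋆`: `f⋆_j = (j+1) ℙ(D = j+1) / 𝔼[D]`, `j ≥ 0`. -/
def sizeBiased : PMF ℕ :=
  ⟨fun j => ((j : ℝ≥0∞) + 1) * L.pmf (j + 1) / L.mean, by
    have h : ∑' j : ℕ, ((j : ℝ≥0∞) + 1) * L.pmf (j + 1) / L.mean = 1 := by
      simp only [div_eq_mul_inv]
      rw [ENNReal.tsum_mul_right, ← L.mean_eq]
      exact ENNReal.mul_inv_cancel L.mean_ne_zero L.mean_ne_top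
    exact (ENNReal.summable.hasSum_iff).mpr h⟩

/-- Offspring law of an individual: `D` for the root `[]`, `D⋆` for everybody else. -/
def offspring : List ℕ → PMF ℕ
  | [] => L.pmf
  | _ :: _ => L.sizeBiased

/-- The sample space. Individuals are labelled by words; the children of `u` are `0 :: u`,
`1 :: u`, …. Every potential individual carries its number of children and one coin. -/
abbrev Env : Type := List ℕ → ℕ × Bool

/-- All numbers of children and all coins are independent; the coins are fair. -/
def envMeasure : Measure Env :=
  Measure.infinitePi fun u : List ℕ =>
    (L.offspring u).toMeasure.prod (PMF.uniformOfFintype Bool).toMeasure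

instance : IsProbabilityMeasure L.envMeasure := by
  unfold envMeasure; infer_instance

end DegreeLaw

namespace BranchingTree

open DegreeLaw

/-- The degree of `u`, that is, its number of children. -/
def deg (ω : Env) (u : List ℕ) : ℕ := (ω u).1

/-- The coin of `u`; it is used at most once, when `u` is coloured. -/
def coin (ω : Env) (u : List ℕ) : Bool := (ω u).2

/-- The individuals of the `k`-th generation. -/
def generation (ω : Env) : ℕ → Finset (List ℕ)
  | 0 => {[]}
  | k + 1 => (generation ω k).biUnion fun u =>
      (Finset.range (deg ω u)).image fun i => i :: u

/-- The size `Z_k` of the `k`-th generation. -/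
def Z (ω : Env) (k : ℕ) : ℕ := (generation ω k).card

/-- `Y = lim_{k → ∞} (τ-2)^k log Z_k`. -/
def limitY (τ : ℝ) (ω : Env) : ℝ :=
  limUnder atTop fun k : ℕ => (τ - 2) ^ k * Real.log (Z ω k)

/-- The generation `κ` at which the process is stopped: the first one that contains an
individual of degree at least `Q`. -/
def stopGen (ω : Env) (Q : ℝ) : ℕ :=
  sInf {j : ℕ | ∃ u ∈ generation ω j, Q ≤ (deg ω u : ℝ)}

inductive Colour : Type
  | uncoloured | red | blue
  deriving DecidableEq

open Classical in
/-- Starting rule, for an individual of degree `d` in the last generation. -/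
def startColour (τ γ Q : ℝ) (d : ℕ) (fair : Bool) : Colour :=
  if (d : ℝ) ∈ Ico Q (Q ^ γ) then Colour.red
  else if (d : ℝ) ∈ Ico (Q ^ γ) (Q ^ (1 / (τ - 2))) then
    (if fair then Colour.blue else Colour.red)
  else Colour.uncoloured

open Classical in
/-- Flow rule, for an individual whose children have the colours in `S`. -/
def flowColour (S : Set Colour) (fair : Bool) : Colour :=
  if Colour.red ∈ S ∧ Colour.blue ∈ S then (if fair then Colour.blue else Colour.red)
  else if Colour.red ∈ S then Colour.red
  else if Colour.blue ∈ S then Colour.blue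
  else Colour.uncoloured

/-- The colour of `u` when the last generation is `r` generations after that of `u`. -/
def colour (τ γ Q : ℝ) (ω : Env) : ℕ → List ℕ → Colour
  | 0, u => startColour τ γ Q (deg ω u) (coin ω u)
  | r + 1, u => flowColour {a | ∃ i < deg ω u, colour τ γ Q ω r (i :: u) = a} (coin ω u)

/-- The colour of the root. -/
def rootColour (τ γ Q : ℝ) (ω : Env) : Colour := colour τ γ Q ω (stopGen ω Q) []

end BranchingTree

namespace DegreeLaw

variable {τ : ℝ} (L : DegreeLaw τ)

/-- The law of `Y`. -/
def lawY : Measure ℝ := L.envMeasure.map (BranchingTree.limitY τ)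

/-- `ℙ(root is painted blue)`. -/
def probRootBlue (γ Q : ℝ) : ℝ :=
  L.envMeasure.real {ω | BranchingTree.rootColour τ γ Q ω = BranchingTree.Colour.blue}

end DegreeLaw

end

/-! Write `α = τ - 2`, let `M_n` be the largest degree in generation `n`, and let `a = -log α`.

Growth. The size-biased law has tail of order `x ^ (-α)`, so its mean is infinite and a generation
of size `z` produces a maximal degree, and also a next generation, of size about `z ^ (1/α)`. Up to
factors `e ^ (±n)` this fails only with summable probability (`measure_slowGrowth_le`,
`measure_fastGrowth_le`). By Borel–Cantelli, `α ^ (n+1) log M_n` converges almost surely to the same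
limit `Y` as `α ^ n log Z_n`.

Upper bound (`probRootBlue_le`). A blue root forces `M_κ ≥ Q ^ γ`, whereas `M_(κ-1) ≤ Q` by
minimality of `κ`. In terms of `Y` this says that, modulo `a`, `log Y` lies in an arc of length
about `a - log γ`. The position of the arc depends on `Q`, so the bound is the largest mass that the
law of `log Y` on the circle `ℝ/aℤ` gives to such an arc. This is less than 1 because that law
charges every open arc: periods can be subtracted until the support hypothesis on `(0, K)` applies.
It tends to 0 with the length of the arc because absolute continuity excludes atoms.

Lower bound (`exists_lower_bound`). A path from the root to an individual with degree in `[Q ^ γ, Q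
^ (1/α))` at the stopping generation, with favourable coins throughout, makes the root blue whatever
the other colours are. If `Y` is near a suitable point, then `M_m < Q` before some generation `k + r
+ 1`, and generation `k` already has a degree large enough to start such a path with high
probability. Here `k` does not depend on `Q`, so the coins in generations `0, …, k` cost only the
fixed factor `2 ^ (-(k+1))`. The `r + 1` later coins cost nothing essential, since each large degree
offers many children to try (`le_real_openPath`). -/

noncomputable section

/-! ### Independence of events determined by disjoint sets of individuals. -/

namespace DegreeLaw

open ProbabilityTheory BranchingTree

/-- The event `E` is determined by the coordinates in `S`. -/
def DeterminedBy (S : Set (List ℕ)) (E : Set Env) : Prop :=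
  ∀ ω ω' : Env, (∀ u ∈ S, ω u = ω' u) → (ω ∈ E ↔ ω' ∈ E)

theorem DeterminedBy.mono {S T : Set (List ℕ)} {E : Set Env} (h : DeterminedBy S E)
    (hST : S ⊆ T) : DeterminedBy T E :=
  fun ω ω' hω => h ω ω' fun u hu => hω u (hST hu)

theorem DeterminedBy.inter {S : Set (List ℕ)} {E F : Set Env} (hE : DeterminedBy S E)
    (hF : DeterminedBy S F) : DeterminedBy S (E ∩ F) :=
  fun ω ω' hω => and_congr (hE ω ω' hω) (hF ω ω' hω)

theorem DeterminedBy.compl {S : Set (List ℕ)} {E : Set Env} (hE : DeterminedBy S E) :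
    DeterminedBy S Eᶜ :=
  fun ω ω' hω => not_congr (hE ω ω' hω)

theorem determinedBy_coord (u : List ℕ) (p : ℕ × Bool → Prop) :
    DeterminedBy {u} {ω | p (ω u)} := by
  intro ω ω' h
  simp only [mem_ofPred_eq, h u rfl]

/-- Overwriting the coordinates outside `S` by a constant does not affect membership in `E`, so `E`
is its own preimage under a map that is measurable for the coordinates in `S`. -/
theorem DeterminedBy.measurableSet_iSup {S : Set (List ℕ)} {E : Set Env}
    (h : DeterminedBy S E) (hE : MeasurableSet E) :
    MeasurableSet[⨆ u ∈ S, MeasurableSpace.comap (fun ω : Env => ω u) inferInstance] E := by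
  classical
  let ext : Env → Env := fun ω u => if u ∈ S then ω u else (0, false)
  have hpre : E = ext ⁻¹' E := by
    ext ω
    exact h ω (ext ω) fun u hu => by simp [ext, hu]
  rw [hpre]
  have hm : @Measurable Env Env
      (⨆ u ∈ S, MeasurableSpace.comap (fun ω : Env => ω u) inferInstance) _ ext := by
    refine @measurable_pi_lambda Env (List ℕ) _ (_) _ ext fun u => ?_
    by_cases hu : u ∈ S
    · simp only [ext, hu, if_true]
      refine Measurable.mono (comap_measurable fun ω : Env => ω u) ?_ le_rfl
      exact le_iSup₂_of_le u hu le_rfl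
    · simp only [ext, hu, if_false]
      exact measurable_const
  exact hm hE

variable {τ : ℝ} (L : DegreeLaw τ)

theorem iIndep_coord :
    iIndep (fun u : List ℕ => MeasurableSpace.comap (fun ω : Env => ω u) inferInstance)
      L.envMeasure :=
  iIndepFun_infinitePi (P := fun u : List ℕ =>
    (L.offspring u).toMeasure.prod (PMF.uniformOfFintype Bool).toMeasure)
    (X := fun _ x => x) (fun _ => measurable_id)

theorem real_inter_of_disjoint {S T : Set (List ℕ)} (hST : Disjoint S T) {E F : Set Env}
    (hE : DeterminedBy S E) (hF : DeterminedBy T F) (mE : MeasurableSet E)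
    (mF : MeasurableSet F) :
    L.envMeasure.real (E ∩ F) = L.envMeasure.real E * L.envMeasure.real F := by
  have h := indep_iSup_of_disjoint (fun u => (measurable_pi_apply u).comap_le) L.iIndep_coord hST
  have h1 := (Indep_iff _ _ _).1 h E F (hE.measurableSet_iSup mE) (hF.measurableSet_iSup mF)
  simp only [Measure.real, h1, ENNReal.toReal_mul]

/-- Induction on `s`: each `E i` is absorbed into `F`, and `S i` into `T`. The extra event `F` later
carries the conditioning on a generation. -/
theorem real_inter_biInter {ι : Type*} (s : Finset ι) (T : Set (List ℕ))
    (S : ι → Set (List ℕ)) (F : Set Env) (E : ι → Set Env)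
    (hTS : ∀ i ∈ s, Disjoint T (S i)) (hS : (s : Set ι).PairwiseDisjoint S)
    (hF : DeterminedBy T F) (mF : MeasurableSet F) (hE : ∀ i ∈ s, DeterminedBy (S i) (E i))
    (mE : ∀ i ∈ s, MeasurableSet (E i)) :
    L.envMeasure.real (F ∩ ⋂ i ∈ s, E i) = L.envMeasure.real F * ∏ i ∈ s, L.envMeasure.real (E i)
    := by
  classical
  induction s using Finset.induction_on generalizing F T with
  | empty => simp
  | insert i s hi ih =>
    rw [Finset.set_biInter_insert, Finset.prod_insert hi, ← inter_assoc]
    have hTi := hTS i (Finset.mem_insert_self i s)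
    have hEi := hE i (Finset.mem_insert_self i s)
    have mEi := mE i (Finset.mem_insert_self i s)
    rw [ih (T ∪ S i) (F ∩ E i) ?_ ?_ ?_ (mF.inter mEi)
      (fun j hj => hE j (Finset.mem_insert_of_mem hj))
      (fun j hj => mE j (Finset.mem_insert_of_mem hj)),
      L.real_inter_of_disjoint hTi hF hEi mF mEi, mul_assoc]
    · intro j hj
      refine Set.disjoint_union_left.2 ⟨hTS j (Finset.mem_insert_of_mem hj), ?_⟩
      exact hS (by simp) (by simp [hj]) (fun h => hi (h ▸ hj))
    · exact hS.subset (by simp)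
    · exact (hF.mono subset_union_left).inter (hEi.mono subset_union_right)

theorem map_coord (u : List ℕ) : L.envMeasure.map (fun ω => ω u) =
    (L.offspring u).toMeasure.prod (PMF.uniformOfFintype Bool).toMeasure :=
  Measure.infinitePi_map_eval _ u

theorem real_deg (u : List ℕ) (A : Set ℕ) :
    L.envMeasure.real {ω | deg ω u ∈ A} = (L.offspring u).toMeasure.real A := by
  have h : {ω : Env | deg ω u ∈ A} = (fun ω : Env => ω u) ⁻¹' (A ×ˢ univ) := by
    ext ω; simp [deg]
  rw [h, ← map_measureReal_apply (measurable_pi_apply u) (MeasurableSet.of_discrete), map_coord,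
    Measure.real, Measure.prod_prod]
  simp [Measure.real]

theorem real_deg_coin (u : List ℕ) (A : Set ℕ) :
    L.envMeasure.real {ω | deg ω u ∈ A ∧ coin ω u = true} =
      (L.offspring u).toMeasure.real A / 2 := by
  have h : {ω : Env | deg ω u ∈ A ∧ coin ω u = true} =
      (fun ω : Env => ω u) ⁻¹' (A ×ˢ {true}) := by
    ext ω; simp [deg, coin]
  rw [h, ← map_measureReal_apply (measurable_pi_apply u) (MeasurableSet.of_discrete), map_coord,
    Measure.real, Measure.prod_prod, PMF.toMeasure_apply_singleton _ _ (MeasurableSet.of_discrete)]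
  simp [Measure.real, div_eq_mul_inv]

end DegreeLaw

/-! ### Generations and their maximal degrees. -/

namespace BranchingTree

open DegreeLaw

theorem mem_generation_zero (ω : Env) (u : List ℕ) : u ∈ generation ω 0 ↔ u = [] := by
  simp [generation]

theorem cons_mem_generation (ω : Env) (k i : ℕ) (u : List ℕ) :
    i :: u ∈ generation ω (k + 1) ↔ u ∈ generation ω k ∧ i < deg ω u := by
  simp [generation]

theorem nil_notMem_generation (ω : Env) (k : ℕ) : [] ∉ generation ω (k + 1) := by
  simp [generation]

theorem length_of_mem_generation {ω : Env} {k : ℕ} {u : List ℕ} (h : u ∈ generation ω k) :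
    u.length = k := by
  induction k generalizing u with
  | zero => simp [(mem_generation_zero ω u).1 h]
  | succ k ih =>
    cases u with
    | nil => exact absurd h (nil_notMem_generation ω k)
    | cons i u => simp [ih ((cons_mem_generation ω k i u).1 h).1]

theorem mem_generation_congr {ω ω' : Env} {k : ℕ} (h : ∀ u : List ℕ, u.length < k →
    deg ω u = deg ω' u) : generation ω k = generation ω' k := by
  induction k with
  | zero => rfl
  | succ k ih =>
    ext u
    cases u with
    | nil => simp [nil_notMem_generation]
    | cons i u =>
      rw [cons_mem_generation, cons_mem_generation, ih fun u hu => h u (by omega)]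
      refine and_congr_right fun hu => ?_
      rw [h u (by rw [length_of_mem_generation hu]; omega)]

theorem measurable_deg (u : List ℕ) : Measurable fun ω : Env => deg ω u :=
  measurable_fst.comp (measurable_pi_apply u)

theorem measurable_coin (u : List ℕ) : Measurable fun ω : Env => coin ω u :=
  measurable_snd.comp (measurable_pi_apply u)

theorem measurableSet_deg (u : List ℕ) (p : ℕ → Prop) : MeasurableSet {ω : Env | p (deg ω u)} :=
  measurable_deg u (MeasurableSet.of_discrete (s := {d | p d}))

theorem measurableSet_mem_generation (k : ℕ) (u : List ℕ) :
    MeasurableSet {ω : Env | u ∈ generation ω k} := by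
  induction k generalizing u with
  | zero => simp [mem_generation_zero]
  | succ k ih =>
    cases u with
    | nil => simp [nil_notMem_generation]
    | cons i u =>
      simp only [cons_mem_generation]
      exact (ih u).inter (measurableSet_deg u fun d => i < d)

theorem measurableSet_generation_eq (k : ℕ) (S : Finset (List ℕ)) :
    MeasurableSet {ω : Env | generation ω k = S} := by
  have h : {ω : Env | generation ω k = S} = ⋂ u, {ω | u ∈ generation ω k ↔ u ∈ S} := by
    ext ω; simp [Finset.ext_iff]
  rw [h]
  refine MeasurableSet.iInter fun u => ?_
  by_cases hu : u ∈ S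
  · simpa [hu] using measurableSet_mem_generation k u
  · simp only [hu, iff_false]
    exact (measurableSet_mem_generation k u).compl

theorem determinedBy_generation_eq (k : ℕ) (S : Finset (List ℕ)) :
    DeterminedBy {u | u.length < k} {ω : Env | generation ω k = S} := by
  intro ω ω' h
  simp only [mem_ofPred_eq]
  rw [mem_generation_congr (ω' := ω') fun u hu => by simp [deg, h u hu]]

/-- The largest degree in generation `k`. -/
def maxDeg (ω : Env) (k : ℕ) : ℕ := (generation ω k).sup (deg ω)

theorem measurable_maxDeg (k : ℕ) : Measurable fun ω : Env => maxDeg ω k := by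
  refine measurable_of_Iic fun m => ?_
  have h : (fun ω : Env => maxDeg ω k) ⁻¹' Iic m =
      ⋂ u : List ℕ, ({ω : Env | u ∈ generation ω k}ᶜ ∪ {ω | deg ω u ≤ m}) := by
    ext ω
    simp only [maxDeg, mem_preimage, mem_Iic, Finset.sup_le_iff, mem_iInter, mem_union,
      mem_compl_iff, mem_ofPred_eq]
    exact forall_congr' fun u => imp_iff_not_or
  rw [h]
  exact MeasurableSet.iInter fun u =>
    (measurableSet_mem_generation k u).compl.union (measurableSet_deg u fun d => d ≤ m)

theorem deg_le_maxDeg {ω : Env} {k : ℕ} {u : List ℕ} (h : u ∈ generation ω k) :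
    deg ω u ≤ maxDeg ω k := Finset.le_sup (f := deg ω) h

theorem exists_deg_eq_maxDeg {ω : Env} {k : ℕ} (h : (generation ω k).Nonempty) :
    ∃ u ∈ generation ω k, deg ω u = maxDeg ω k := by
  obtain ⟨u, hu, h1⟩ := Finset.exists_mem_eq_sup _ h (deg ω)
  exact ⟨u, hu, h1.symm⟩

theorem deg_le_Z {ω : Env} {k : ℕ} {u : List ℕ} (h : u ∈ generation ω k) :
    deg ω u ≤ Z ω (k + 1) := by
  have h1 : (Finset.range (deg ω u)).image (fun i => i :: u) ⊆ generation ω (k + 1) := by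
    intro w hw
    obtain ⟨i, hi, rfl⟩ := Finset.mem_image.1 hw
    exact (cons_mem_generation ω k i u).2 ⟨h, Finset.mem_range.1 hi⟩
  have h2 := Finset.card_le_card h1
  rwa [Finset.card_image_of_injective _ (fun i j h => (List.cons.inj h).1),
    Finset.card_range] at h2

theorem maxDeg_le_Z (ω : Env) (k : ℕ) : maxDeg ω k ≤ Z ω (k + 1) :=
  Finset.sup_le fun _ hu => deg_le_Z hu

theorem Z_succ_le (ω : Env) (k : ℕ) : Z ω (k + 1) ≤ ∑ u ∈ generation ω k, deg ω u := by
  refine Finset.card_biUnion_le.trans (Finset.sum_le_sum fun u _ => ?_)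
  exact Finset.card_image_le.trans (Finset.card_range _).le

theorem Z_pos {ω : Env} (h : ∀ u, 1 ≤ deg ω u) (k : ℕ) : 1 ≤ Z ω k := by
  induction k with
  | zero => simp [Z, generation]
  | succ k ih =>
    obtain ⟨u, hu⟩ := Finset.card_pos.1 ih
    exact (h u).trans (deg_le_Z hu)

end BranchingTree

namespace DegreeLaw

open BranchingTree

variable {τ : ℝ} (L : DegreeLaw τ)

theorem sizeBiased_zero : L.sizeBiased 0 = 0 := by
  change ((0 : ℕ) + 1 : ℝ≥0∞) * L.pmf (0 + 1) / L.mean = 0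
  simp [L.one_eq]

theorem offspring_zero (u : List ℕ) : L.offspring u 0 = 0 := by
  cases u with
  | nil => exact L.zero_eq
  | cons => exact L.sizeBiased_zero

theorem ae_one_le_deg : ∀ᵐ ω ∂L.envMeasure, ∀ u, 1 ≤ deg ω u := by
  refine ae_all_iff.2 fun u => ?_
  have h := L.real_deg u {0}
  rw [Measure.real, Measure.real, PMF.toMeasure_apply_singleton _ _ (MeasurableSet.of_discrete),
    offspring_zero] at h
  have h1 : L.envMeasure {ω | deg ω u ∈ ({0} : Set ℕ)} = 0 := by
    rcases (ENNReal.toReal_eq_zero_iff _).1 (by simpa using h) with h | h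
    · exact h
    · exact absurd h (measure_ne_top _ _)
  rw [ae_iff]
  convert h1 using 2
  ext ω; simp

end DegreeLaw

/-! ### Power sums and the tail of the size-biased law. -/

theorem sum_rpow_neg_le {α : ℝ} (h0 : 0 < α) (h1 : α < 1) (N : ℕ) :
    ∑ j ∈ Finset.range N, ((j : ℝ) + 1) ^ (-α) ≤ (N : ℝ) ^ (1 - α) / (1 - α) := by
  have h2 : 0 < 1 - α := by linarith
  induction N with
  | zero => simp [Real.zero_rpow h2.ne']
  | succ N ih =>
    rw [Finset.sum_range_succ]
    have hN : (0 : ℝ) < (N : ℝ) + 1 := by positivity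
    -- Bernoulli's inequality for an exponent below 1 replaces comparison with an integral: it
    -- bounds one increment of `x ^ (1 - α)` from below.
    have hB := rpow_one_add_le_one_add_mul_self (s := -(1 / ((N : ℝ) + 1))) (p := 1 - α)
      (by rw [neg_le_neg_iff, div_le_one hN]; linarith [N.cast_nonneg (α := ℝ)]) h2.le
      (by linarith)
    have e1 : (N : ℝ) ^ (1 - α) = (1 + -(1 / ((N : ℝ) + 1))) ^ (1 - α) * ((N : ℝ) + 1) ^ (1 - α) := by
      rw [← Real.mul_rpow _ hN.le]
      · congr 1; field_simp; ring
      · rw [show 1 + -(1 / ((N : ℝ) + 1)) = N / (N + 1) by field_simp; ring]; positivity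
    have e2 : ((N : ℝ) + 1) ^ (1 - α) = ((N : ℝ) + 1) ^ (-α) * (N + 1) := by
      rw [show 1 - α = -α + 1 by ring, Real.rpow_add_one hN.ne']
    have hp : 0 < ((N : ℝ) + 1) ^ (-α) := by positivity
    have e3 : (N : ℝ) ^ (1 - α) ≤ ((N : ℝ) + 1) ^ (1 - α) - (1 - α) * ((N : ℝ) + 1) ^ (-α) := by
      rw [e1]
      calc _ ≤ (1 + (1 - α) * -(1 / ((N : ℝ) + 1))) * ((N : ℝ) + 1) ^ (1 - α) := by gcongr
        _ = _ := by rw [e2]; field_simp; ring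
    have e4 := (div_le_div_iff_of_pos_right h2).2 e3
    have e5 : (((N : ℝ) + 1) ^ (1 - α) - (1 - α) * ((N : ℝ) + 1) ^ (-α)) / (1 - α) =
        ((N : ℝ) + 1) ^ (1 - α) / (1 - α) - ((N : ℝ) + 1) ^ (-α) := by field_simp
    push_cast
    linarith

theorem rpow_neg_succ_le {α : ℝ} (h0 : 0 < α) (h1 : α < 1) {N : ℕ} (hN : 1 ≤ N) :
    ((N : ℝ) + 1) ^ (-1 - α) ≤ ((N : ℝ) ^ (-α) - ((N : ℝ) + 1) ^ (-α)) / α := by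
  have hN0 : (0 : ℝ) < N := by exact_mod_cast hN
  have hN1 : (0 : ℝ) < (N : ℝ) + 1 := by positivity
  have hB := rpow_one_add_le_one_add_mul_self (s := -(1 / ((N : ℝ) + 1))) (p := α)
    (by rw [neg_le_neg_iff, div_le_one hN1]; linarith) h0.le h1.le
  rw [show 1 + -(1 / ((N : ℝ) + 1)) = N / (N + 1) by field_simp; ring,
    Real.div_rpow hN0.le hN1.le] at hB
  rw [le_div_iff₀ h0, show -1 - α = -α - 1 by ring, Real.rpow_sub_one hN1.ne',
    Real.rpow_neg hN0.le, Real.rpow_neg hN1.le]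
  set a := (N : ℝ) ^ α
  set b := ((N : ℝ) + 1) ^ α
  have ha : 0 < a := by positivity
  have hb : 0 < b := by positivity
  have h2 : a ≤ b * (1 - α / (N + 1)) := by
    rw [div_le_iff₀ hb] at hB
    calc a ≤ _ := hB
      _ = _ := by field_simp; ring
  have h3 : b⁻¹ * (1 + α / (N + 1)) ≤ a⁻¹ := by
    rw [inv_mul_le_iff₀ hb, ← div_eq_mul_inv, le_div_iff₀ ha]
    have h4 : 0 < α / ((N : ℝ) + 1) := by positivity
    nlinarith [mul_le_mul_of_nonneg_left h2 (by positivity : 0 ≤ 1 + α / ((N : ℝ) + 1)),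
      mul_nonneg hb.le (sq_nonneg (α / ((N : ℝ) + 1)))]
  calc b⁻¹ / ((N : ℝ) + 1) * α = b⁻¹ * (1 + α / (N + 1)) - b⁻¹ := by field_simp; ring
    _ ≤ _ := by linarith

/-- Split at `⌊T⌋`. Below it the summand is at most `(j+1) ^ (-α)`; above it the minimum is at most
`T`, and the remaining powers telescope by `rpow_neg_succ_le`. -/
theorem sum_min_mul_rpow_le {α : ℝ} (h0 : 0 < α) (h1 : α < 1) {T : ℝ} (hT : 1 ≤ T) (M : ℕ) :
    ∑ j ∈ Finset.range M, min ((j : ℝ) + 1) T * ((j : ℝ) + 1) ^ (-1 - α) ≤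
      (1 / (1 - α) + 2 / α) * T ^ (1 - α) := by
  have h2 : 0 < 1 - α := by linarith
  have hT0 : 0 < T := by linarith
  set N := ⌊T⌋₊
  have hN1 : 1 ≤ N := (Nat.one_le_floor_iff T).2 hT
  have hNT : (N : ℝ) ≤ T := Nat.floor_le hT0.le
  have hTN : T < N + 1 := Nat.lt_floor_add_one T
  have hN0 : (0 : ℝ) < N := by exact_mod_cast hN1
  have hN1' : (1 : ℝ) ≤ N := by exact_mod_cast hN1
  have head : ∑ j ∈ Finset.range N, min ((j : ℝ) + 1) T * ((j : ℝ) + 1) ^ (-1 - α) ≤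
      T ^ (1 - α) / (1 - α) := by
    calc _ ≤ ∑ j ∈ Finset.range N, ((j : ℝ) + 1) ^ (-α) := by
          refine Finset.sum_le_sum fun j _ => ?_
          have hj : (0 : ℝ) < (j : ℝ) + 1 := by positivity
          rw [show -1 - α = -α - 1 by ring, Real.rpow_sub_one hj.ne']
          calc _ ≤ ((j : ℝ) + 1) * (((j : ℝ) + 1) ^ (-α) / ((j : ℝ) + 1)) := by
                gcongr; exact min_le_left _ _
            _ = _ := by field_simp
      _ ≤ (N : ℝ) ^ (1 - α) / (1 - α) := sum_rpow_neg_le h0 h1 N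
      _ ≤ _ := by gcongr
  have tail : T * (N : ℝ) ^ (-α) ≤ 2 * T ^ (1 - α) := by
    have h3 : (T / 2) ^ α ≤ (N : ℝ) ^ α := by gcongr; linarith
    have h4 : (2 : ℝ) ^ α ≤ 2 := by
      calc (2 : ℝ) ^ α ≤ 2 ^ (1 : ℝ) := by gcongr; norm_num
        _ = 2 := by simp
    rw [Real.div_rpow hT0.le (by norm_num)] at h3
    rw [Real.rpow_neg hN0.le, Real.rpow_sub hT0, Real.rpow_one]
    have hp : 0 < (N : ℝ) ^ α := by positivity
    have hq : 0 < T ^ α := by positivity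
    have h5 : T ^ α ≤ (N : ℝ) ^ α * 2 := by
      rw [div_le_iff₀ (by positivity)] at h3
      exact h3.trans (by gcongr)
    rw [← div_eq_mul_inv, ← mul_div_assoc, div_le_div_iff₀ hp hq]
    nlinarith
  have main : ∀ M, N ≤ M →
      ∑ j ∈ Finset.range M, min ((j : ℝ) + 1) T * ((j : ℝ) + 1) ^ (-1 - α) ≤
        T ^ (1 - α) / (1 - α) + T * (((N : ℝ) ^ (-α) - (M : ℝ) ^ (-α)) / α) := by
    intro M hM
    induction M, hM using Nat.le_induction with
    | base => simpa using head
    | succ M hM ih =>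
      rw [Finset.sum_range_succ]
      have h3 := rpow_neg_succ_le h0 h1 (hN1.trans hM)
      have h4 : min ((M : ℝ) + 1) T * ((M : ℝ) + 1) ^ (-1 - α) ≤
          T * (((M : ℝ) ^ (-α) - ((M : ℝ) + 1) ^ (-α)) / α) := by
        refine mul_le_mul (min_le_right _ _) h3 (by positivity) hT0.le
      push_cast
      calc _ ≤ _ := add_le_add ih h4
        _ = _ := by ring
  calc _ ≤ ∑ j ∈ Finset.range (max N M), min ((j : ℝ) + 1) T * ((j : ℝ) + 1) ^ (-1 - α) := by
        refine Finset.sum_le_sum_of_subset_of_nonneg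
          (Finset.range_subset_range.2 (le_max_right _ _)) fun j _ _ => ?_
        have : 0 ≤ min ((j : ℝ) + 1) T := le_min (by positivity) hT0.le
        positivity
    _ ≤ _ := main _ (le_max_left _ _)
    _ ≤ T ^ (1 - α) / (1 - α) + T * ((N : ℝ) ^ (-α) / α) := by
        gcongr
        linarith [Real.rpow_nonneg (Nat.cast_nonneg (α := ℝ) (max N M)) (-α)]
    _ = T ^ (1 - α) / (1 - α) + T * (N : ℝ) ^ (-α) / α := by ring
    _ ≤ T ^ (1 - α) / (1 - α) + 2 * T ^ (1 - α) / α := by gcongr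
    _ = _ := by ring

/-- This permits summation by parts: an expectation of `D * min D T` becomes a sum over the tails of
`D`. -/
theorem mul_min_le_sum {T : ℝ} (hT : 0 ≤ T) (k : ℕ) :
    (k : ℝ) * min (k : ℝ) T ≤ ∑ i ∈ Finset.range k, 2 * min ((i : ℝ) + 1) T := by
  induction k with
  | zero => simp
  | succ k ih =>
    rw [Finset.sum_range_succ]
    push_cast
    have hk : (0 : ℝ) ≤ k := k.cast_nonneg
    have h : ((k : ℝ) - 1) * min ((k : ℝ) + 1) T ≤ k * min (k : ℝ) T := by
      rcases le_total T k with h | h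
      · rw [min_eq_right h, min_eq_right (by linarith)]
        nlinarith
      · rw [min_eq_left h]
        have h1 : min ((k : ℝ) + 1) T ≤ k + 1 := min_le_left _ _
        have h2 : 0 ≤ min ((k : ℝ) + 1) T := le_min (by linarith) hT
        rcases Nat.eq_zero_or_pos k with rfl | h3
        · simp; linarith
        · have h4 : (1 : ℝ) ≤ k := by exact_mod_cast h3
          nlinarith
    linarith

namespace DegreeLaw

variable {τ : ℝ} (L : DegreeLaw τ)

theorem mean_toReal_pos : 0 < L.mean.toReal :=
  ENNReal.toReal_pos L.mean_ne_zero L.mean_ne_top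

theorem sizeBiased_apply (j : ℕ) :
    L.sizeBiased j = ((j : ℝ≥0∞) + 1) * L.pmf (j + 1) / L.mean := rfl

/-- Above level `x` the size-biasing weight is at least `(x + 1) / 𝔼[D]`, which lowers the tail
exponent from `τ - 1` to `τ - 2`. -/
theorem sizeBiased_tail_lower : ∃ c : ℝ, 0 < c ∧ ∀ x : ℝ, 1 ≤ x →
    c * x ^ (-(τ - 2)) ≤ L.sizeBiased.toMeasure.real {k : ℕ | x ≤ (k : ℝ)} := by
  obtain ⟨c, hc, hlow⟩ := L.tail_lower
  have hm := L.mean_toReal_pos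
  have h2 := L.two_lt
  refine ⟨c * 2 ^ (-(τ - 2)) / L.mean.toReal, by positivity, fun x hx => ?_⟩
  have h1 := hlow (x + 1) (by linarith)
  have hx0 : 0 < x := by linarith
  have key : ENNReal.ofReal (x + 1) / L.mean * L.pmf.toMeasure {k : ℕ | x + 1 < (k : ℝ)} ≤
      L.sizeBiased.toMeasure {k : ℕ | x ≤ (k : ℝ)} := by
    rw [PMF.toMeasure_apply _ (MeasurableSet.of_discrete),
      PMF.toMeasure_apply _ (MeasurableSet.of_discrete), tsum_eq_zero_add' ENNReal.summable,
      indicator_of_notMem (by simp; linarith), zero_add, ← ENNReal.tsum_mul_left]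
    refine ENNReal.tsum_le_tsum fun k => ?_
    by_cases hk : x + 1 < ((k + 1 : ℕ) : ℝ)
    · have hk' : x ≤ k := by push_cast at hk; linarith
      rw [indicator_of_mem (by exact hk), indicator_of_mem (by exact hk'), sizeBiased_apply,
        div_eq_mul_inv, div_eq_mul_inv, mul_right_comm]
      gcongr
      rw [← ENNReal.ofReal_natCast, ← ENNReal.ofReal_one, ← ENNReal.ofReal_add (by positivity) (by norm_num)]
      exact ENNReal.ofReal_le_ofReal (by linarith)
    · rw [indicator_of_notMem (by exact hk)]
      simp
  have key2 := ENNReal.toReal_mono (measure_ne_top _ _) key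
  rw [ENNReal.toReal_mul, ENNReal.toReal_div, ENNReal.toReal_ofReal (by linarith)] at key2
  refine le_trans ?_ key2
  change _ ≤ _ * L.pmf.toMeasure.real _
  calc _ = c * (2 * x) ^ (-(τ - 2)) / L.mean.toReal := by
        rw [Real.mul_rpow (by norm_num) hx0.le]; ring
    _ ≤ c * (x + 1) ^ (-(τ - 2)) / L.mean.toReal := by
        gcongr ?_ / _
        refine mul_le_mul_of_nonneg_left ?_ hc.le
        exact Real.rpow_le_rpow_of_nonpos (by linarith) (by linarith) (by linarith)
    _ = (x + 1) / L.mean.toReal * (c / (x + 1) ^ (τ - 1)) := by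
        rw [show -(τ - 2) = 1 - (τ - 1) by ring, Real.rpow_sub (by linarith), Real.rpow_one]
        ring
    _ ≤ _ := by gcongr

/-- The truncated mean is at most `𝔼[D min(D, T)] / 𝔼[D]`; summation by parts and the tail bound for
`D` reduce this to `sum_min_mul_rpow_le`. Truncation is indispensable because `D⋆` has infinite
mean. -/
theorem sizeBiased_truncated_mean : ∃ C : ℝ, 0 < C ∧ ∀ T : ℝ, 1 ≤ T →
    ∑' j : ℕ, ENNReal.ofReal (min (j : ℝ) T) * L.sizeBiased j ≤
      ENNReal.ofReal (C * T ^ (1 - (τ - 2))) := by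
  obtain ⟨C, hC, hup⟩ := L.tail_upper
  have hm := L.mean_toReal_pos
  have h2 := L.two_lt
  have h3 := L.lt_three
  set α := τ - 2 with hα
  have hα0 : 0 < α := by simp only [hα]; linarith
  have hα1 : α < 1 := by simp only [hα]; linarith
  have hα2 : 0 < 1 - α := by linarith
  refine ⟨(2 + 4 * C * (1 / (1 - α) + 2 / α)) / L.mean.toReal, by positivity, fun T hT => ?_⟩
  have hT0 : 0 < T := by linarith
  have hmin : ∀ i : ℕ, 0 ≤ min ((i : ℝ) + 1) T := fun i => le_min (by positivity) hT0.le
  have s1 : ∑' j : ℕ, ENNReal.ofReal (min (j : ℝ) T) * L.sizeBiased j ≤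
      (∑' k : ℕ, ENNReal.ofReal (k * min (k : ℝ) T) * L.pmf k) / L.mean := by
    rw [tsum_eq_zero_add' ENNReal.summable (f := fun k : ℕ => ENNReal.ofReal (k * min (k : ℝ) T) * L.pmf k),
      L.zero_eq, mul_zero, zero_add, div_eq_mul_inv, ← ENNReal.tsum_mul_right]
    refine ENNReal.tsum_le_tsum fun j => ?_
    rw [sizeBiased_apply, div_eq_mul_inv, ← mul_assoc, ← mul_assoc]
    gcongr
    rw [← ENNReal.ofReal_natCast, ← ENNReal.ofReal_one,
      ← ENNReal.ofReal_add (by positivity) (by norm_num),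
      ← ENNReal.ofReal_mul (le_min (by positivity) hT0.le)]
    apply ENNReal.ofReal_le_ofReal
    push_cast
    rw [mul_comm]
    gcongr
    linarith
  have s2 : ∑' k : ℕ, ENNReal.ofReal (k * min (k : ℝ) T) * L.pmf k ≤
      ∑' i : ℕ, ENNReal.ofReal (2 * min ((i : ℝ) + 1) T) * L.pmf.toMeasure {k : ℕ | i < k} := by
    have h4 : ∀ k : ℕ, ENNReal.ofReal (k * min (k : ℝ) T) * L.pmf k ≤
        ∑' i : ℕ, ENNReal.ofReal (2 * min ((i : ℝ) + 1) T) *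
          (if i < k then L.pmf k else 0) := by
      intro k
      rw [tsum_eq_sum (s := Finset.range k) (fun n hn => by
        rw [if_neg (by simpa using hn), mul_zero])]
      rw [Finset.sum_congr rfl (fun n hn => by rw [if_pos (by simpa using hn)]),
        ← Finset.sum_mul, ← ENNReal.ofReal_sum_of_nonneg fun i _ => by linarith [hmin i]]
      gcongr
      exact mul_min_le_sum hT0.le k
    refine (ENNReal.tsum_le_tsum h4).trans ?_
    rw [ENNReal.tsum_comm]
    refine ENNReal.tsum_le_tsum fun i => ?_
    rw [ENNReal.tsum_mul_left, PMF.toMeasure_apply _ (MeasurableSet.of_discrete)]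
    gcongr with k
    simp [indicator_apply]
  have s3 : ∑' i : ℕ, ENNReal.ofReal (2 * min ((i : ℝ) + 1) T) * L.pmf.toMeasure {k : ℕ | i < k} ≤
      ENNReal.ofReal ((2 + 4 * C * (1 / (1 - α) + 2 / α)) * T ^ (1 - α)) := by
    have hT1 : 1 ≤ T ^ (1 - α) := Real.one_le_rpow hT hα2.le
    rw [tsum_eq_zero_add' ENNReal.summable, add_mul, ENNReal.ofReal_add (by positivity) (by positivity)]
    gcongr
    · calc _ ≤ ENNReal.ofReal (2 * min (((0 : ℕ) : ℝ) + 1) T) * 1 := by gcongr; exact prob_le_one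
        _ ≤ _ := by
          rw [mul_one]
          apply ENNReal.ofReal_le_ofReal
          have := min_le_left (((0 : ℕ) : ℝ) + 1) T
          push_cast at this ⊢
          linarith
    · refine ENNReal.tsum_le_of_sum_range_le fun M => ?_
      have h5 : ∀ j : ℕ, ENNReal.ofReal (2 * min (((j + 1 : ℕ) : ℝ) + 1) T) *
          L.pmf.toMeasure {k : ℕ | j + 1 < k} ≤
          ENNReal.ofReal (4 * C * (min ((j : ℝ) + 1) T * ((j : ℝ) + 1) ^ (-1 - α))) := by
        intro j
        have h6 := hup ((j + 1 : ℕ) : ℝ) (by push_cast; linarith [j.cast_nonneg (α := ℝ)])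
        rw [show {k : ℕ | (((j + 1 : ℕ) : ℝ)) < (k : ℝ)} = {k : ℕ | j + 1 < k} by
          ext k; simp only [Set.mem_ofPred_eq, Nat.cast_lt]] at h6
        rw [← ENNReal.ofReal_toReal (measure_ne_top L.pmf.toMeasure {k : ℕ | j + 1 < k}),
          ← ENNReal.ofReal_mul (by linarith [hmin (j + 1)])]
        apply ENNReal.ofReal_le_ofReal
        change _ * L.pmf.toMeasure.real _ ≤ _
        have h7 : min (((j + 1 : ℕ) : ℝ) + 1) T ≤ 2 * min ((j : ℝ) + 1) T := by
          push_cast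
          rcases le_total ((j : ℝ) + 1) T with h | h
          · rw [min_eq_left h]
            exact (min_le_left _ _).trans (by linarith [j.cast_nonneg (α := ℝ)])
          · rw [min_eq_right h]
            exact (min_le_right _ _).trans (by linarith)
        have h8 : C / ((j + 1 : ℕ) : ℝ) ^ (τ - 1) = C * ((j : ℝ) + 1) ^ (-1 - α) := by
          rw [show -1 - α = -(τ - 1) by simp only [hα]; ring, Real.rpow_neg (by positivity)]
          push_cast
          rfl
        calc _ ≤ (2 * (2 * min ((j : ℝ) + 1) T)) * (C * ((j : ℝ) + 1) ^ (-1 - α)) := by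
              rw [← h8]
              gcongr
          _ = _ := by ring
      refine (Finset.sum_le_sum fun j _ => h5 j).trans ?_
      rw [← ENNReal.ofReal_sum_of_nonneg fun j _ => by have := hmin j; positivity, ← Finset.mul_sum]
      apply ENNReal.ofReal_le_ofReal
      have h9 := sum_min_mul_rpow_le hα0 hα1 hT M
      calc _ ≤ _ := mul_le_mul_of_nonneg_left h9 (by positivity : 0 ≤ 4 * C)
        _ = _ := by ring
  calc _ ≤ _ := s1
    _ ≤ ENNReal.ofReal ((2 + 4 * C * (1 / (1 - α) + 2 / α)) * T ^ (1 - α)) / L.mean := by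
        gcongr; exact s2.trans s3
    _ = _ := by
        rw [← ENNReal.ofReal_toReal L.mean_ne_top, ← ENNReal.ofReal_div_of_pos hm,
          ENNReal.toReal_ofReal hm.le]
        congr 1; ring

/-- Markov's inequality for the variable truncated at `x` itself. -/
theorem sizeBiased_tail_upper : ∃ C : ℝ, 0 < C ∧ ∀ x : ℝ, 1 ≤ x →
    L.sizeBiased.toMeasure.real {k : ℕ | x ≤ (k : ℝ)} ≤ C * x ^ (-(τ - 2)) := by
  obtain ⟨C, hC, h⟩ := L.sizeBiased_truncated_mean
  refine ⟨C, hC, fun x hx => ?_⟩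
  have hx0 : 0 < x := by linarith
  have h1 : ENNReal.ofReal x * L.sizeBiased.toMeasure {k : ℕ | x ≤ (k : ℝ)} ≤
      ENNReal.ofReal (C * x ^ (1 - (τ - 2))) := by
    refine le_trans ?_ (h x hx)
    rw [PMF.toMeasure_apply _ (MeasurableSet.of_discrete), ← ENNReal.tsum_mul_left]
    refine ENNReal.tsum_le_tsum fun k => ?_
    by_cases hk : x ≤ k
    · rw [indicator_of_mem (by exact hk), min_eq_right hk]
    · rw [indicator_of_notMem (by exact hk)]; simp
  have h2 := ENNReal.toReal_mono ENNReal.ofReal_ne_top h1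
  rw [ENNReal.toReal_mul, ENNReal.toReal_ofReal hx0.le, ENNReal.toReal_ofReal (by positivity)] at h2
  change x * L.sizeBiased.toMeasure.real _ ≤ _ at h2
  rw [show 1 - (τ - 2) = -(τ - 2) + 1 by ring, Real.rpow_add_one hx0.ne'] at h2
  have h3 : x * L.sizeBiased.toMeasure.real {k : ℕ | x ≤ (k : ℝ)} ≤ x * (C * x ^ (-(τ - 2))) := by
    linarith
  exact le_of_mul_le_mul_left h3 hx0

end DegreeLaw

/-! ### Double-exponential growth of the generations. -/

namespace DegreeLaw

open BranchingTree

variable {τ : ℝ} (L : DegreeLaw τ)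

theorem measure_inter_of_disjoint {S T : Set (List ℕ)} (hST : Disjoint S T) {E F : Set Env}
    (hE : DeterminedBy S E) (hF : DeterminedBy T F) (mE : MeasurableSet E)
    (mF : MeasurableSet F) :
    L.envMeasure (E ∩ F) = L.envMeasure E * L.envMeasure F := by
  have h := L.real_inter_of_disjoint hST hE hF mE mF
  rw [Measure.real, Measure.real, Measure.real, ← ENNReal.toReal_mul] at h
  exact (ENNReal.toReal_eq_toReal_iff' (measure_ne_top _ _)
    (ENNReal.mul_ne_top (measure_ne_top _ _) (measure_ne_top _ _))).1 h

theorem offspring_of_ne_nil {u : List ℕ} (hu : u ≠ []) : L.offspring u = L.sizeBiased := by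
  cases u with
  | nil => exact absurd rfl hu
  | cons => rfl

/-- Total probability over the countably many possible values of generation `n`. -/
theorem measure_le_of_forall_generation (n : ℕ) (E : Set Env) (q : ℝ≥0∞)
    (h : ∀ S : Finset (List ℕ), (∀ u ∈ S, u.length = n) →
      L.envMeasure (E ∩ {ω | generation ω n = S}) ≤
        L.envMeasure {ω | generation ω n = S} * q) : L.envMeasure E ≤ q := by
  have h1 : ∀ S : Finset (List ℕ), L.envMeasure (E ∩ {ω | generation ω n = S}) ≤
      L.envMeasure {ω | generation ω n = S} * q := by
    intro S
    by_cases hS : ∀ u ∈ S, u.length = n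
    · exact h S hS
    · have h2 : E ∩ {ω | generation ω n = S} = ∅ := by
        refine eq_empty_of_forall_notMem fun ω hω => hS fun u hu => ?_
        exact length_of_mem_generation (ω := ω) (by rw [hω.2]; exact hu)
      simp [h2]
  have h3 : E ⊆ ⋃ S : Finset (List ℕ), E ∩ {ω | generation ω n = S} := by
    intro ω hω
    exact mem_iUnion.2 ⟨generation ω n, hω, rfl⟩
  calc L.envMeasure E ≤ _ := measure_mono h3
    _ ≤ ∑' S : Finset (List ℕ), L.envMeasure (E ∩ {ω | generation ω n = S}) :=
        measure_iUnion_le _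
    _ ≤ ∑' S : Finset (List ℕ), L.envMeasure {ω | generation ω n = S} * q :=
        ENNReal.tsum_le_tsum h1
    _ = L.envMeasure (⋃ S : Finset (List ℕ), {ω | generation ω n = S}) * q := by
        rw [ENNReal.tsum_mul_right, measure_iUnion]
        · intro S S' hSS'
          exact Set.disjoint_left.2 fun ω hω hω' => hSS' (hω.symm.trans hω')
        · exact measurableSet_generation_eq n
    _ ≤ 1 * q := by gcongr; exact prob_le_one
    _ = q := one_mul q

/-- All degrees in generation `n` are smaller than `Z_n ^ (1/α) e^{-n}`. -/
def slowGrowth (α : ℝ) (n : ℕ) : Set Env :=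
  {ω | 1 ≤ (Z ω n : ℝ) ^ (1 / α) * Real.exp (-n) ∧
    ∀ u ∈ generation ω n, (deg ω u : ℝ) < (Z ω n : ℝ) ^ (1 / α) * Real.exp (-n)}

/-- Generation `n + 1` is larger than `Z_n ^ (1/α) e^n`. -/
def fastGrowth (α : ℝ) (n : ℕ) : Set Env :=
  {ω | 1 ≤ Z ω n ∧ (Z ω n : ℝ) ^ (1 / α) * Real.exp n < Z ω (n + 1)}

/-- Given `Z_n = z`, the degrees are independent and each reaches `t = z ^ (1/α) e ^ (-n)` with
probability at least `c t ^ (-α)`. Since `z t ^ (-α) = e ^ (α n)`, all of them stay below `t` with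
probability at most `exp (-c e ^ (α n))`. The restriction `1 ≤ n` excludes the root, whose offspring
law is different. -/
theorem measure_slowGrowth_le : ∃ C : ℝ, 0 < C ∧ ∀ n : ℕ, 1 ≤ n →
    L.envMeasure (slowGrowth (τ - 2) n) ≤ ENNReal.ofReal (C * Real.exp (-(τ - 2)) ^ n) := by
  obtain ⟨c, hc, hlow⟩ := L.sizeBiased_tail_lower
  have h2 := L.two_lt
  set α := τ - 2 with hα
  have hα0 : 0 < α := by simp only [hα]; linarith
  refine ⟨1 / c, by positivity, fun n hn => ?_⟩
  refine L.measure_le_of_forall_generation n _ _ fun S hS => ?_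
  set t : ℝ := (S.card : ℝ) ^ (1 / α) * Real.exp (-n) with ht
  by_cases ht1 : 1 ≤ t
  swap
  · have : slowGrowth α n ∩ {ω | generation ω n = S} = ∅ := by
      refine eq_empty_of_forall_notMem fun ω hω => ht1 ?_
      have h3 := hω.1.1
      rwa [Z, show generation ω n = S from hω.2] at h3
    simp [this]
  have hsub : slowGrowth α n ∩ {ω | generation ω n = S} ⊆
      {ω | generation ω n = S} ∩ ⋂ u ∈ S, {ω | deg ω u ∈ {k : ℕ | (k : ℝ) < t}} := by
    intro ω hω
    have hg : generation ω n = S := hω.2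
    refine ⟨hg, mem_iInter₂.2 fun u hu => ?_⟩
    have h3 := hω.1.2 u (by rw [hg]; exact hu)
    rwa [Z, hg] at h3
  have hprod := L.real_inter_biInter S {u | u.length < n} (fun u => {u})
    {ω | generation ω n = S} (fun u => {ω | deg ω u ∈ {k : ℕ | (k : ℝ) < t}})
    (fun u hu => by simp [hS u hu]) (fun u _ v _ huv => by simpa using huv)
    (determinedBy_generation_eq n S) (measurableSet_generation_eq n S)
    (fun u _ => determinedBy_coord u fun x => x.1 ∈ {k : ℕ | (k : ℝ) < t})
    (fun u _ => measurableSet_deg u fun d => d ∈ {k : ℕ | (k : ℝ) < t})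
  have hz : (0 : ℝ) < S.card := by
    have : S.card ≠ 0 := by
      intro h0
      rw [ht, h0] at ht1
      simp [Real.zero_rpow (inv_ne_zero hα0.ne')] at ht1
      linarith
    exact_mod_cast Nat.pos_of_ne_zero this
  have ht0 : 0 < t := by linarith
  have hq : ∀ u ∈ S, L.envMeasure.real {ω | deg ω u ∈ {k : ℕ | (k : ℝ) < t}} ≤
      Real.exp (-(c * t ^ (-α))) := by
    intro u hu
    have hu0 : u ≠ [] := by
      rintro rfl
      have := hS _ hu
      simp at this
      omega
    rw [real_deg, offspring_of_ne_nil L hu0,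
      show {k : ℕ | (k : ℝ) < t} = {k : ℕ | t ≤ (k : ℝ)}ᶜ by ext; simp,
      probReal_compl_eq_one_sub (MeasurableSet.of_discrete)]
    have := Real.add_one_le_exp (-(c * t ^ (-α)))
    have := hlow t ht1
    linarith
  have hprod2 : ∏ u ∈ S, L.envMeasure.real {ω | deg ω u ∈ {k : ℕ | (k : ℝ) < t}} ≤
      1 / c * Real.exp (-α) ^ n := by
    calc _ ≤ ∏ u ∈ S, Real.exp (-(c * t ^ (-α))) :=
          Finset.prod_le_prod (fun _ _ => measureReal_nonneg) hq
      _ = Real.exp (-(c * (S.card * t ^ (-α)))) := by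
          rw [Finset.prod_const, ← Real.exp_nat_mul]; congr 1; ring
      _ = Real.exp (-(c * Real.exp (α * n))) := by
          congr 3
          rw [ht, Real.mul_rpow (by positivity) (by positivity), ← Real.rpow_mul hz.le,
            ← Real.exp_mul, show 1 / α * -α = -1 by field_simp, Real.rpow_neg_one,
            ← mul_assoc, mul_inv_cancel₀ hz.ne', one_mul]
          congr 1; ring
      _ ≤ 1 / (c * Real.exp (α * n)) := by
          rw [Real.exp_neg, one_div]
          gcongr
          linarith [Real.add_one_le_exp (c * Real.exp (α * n))]
      _ = 1 / c * Real.exp (-α) ^ n := by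
          rw [← Real.exp_nat_mul, show (n : ℝ) * -α = -(α * n) by ring, Real.exp_neg]
          field_simp
  refine (measure_mono hsub).trans ?_
  rw [← ENNReal.ofReal_toReal (measure_ne_top L.envMeasure (_ ∩ ⋂ u ∈ S, _)),
    ← ENNReal.ofReal_toReal (measure_ne_top L.envMeasure {ω | generation ω n = S}),
    ← ENNReal.ofReal_mul ENNReal.toReal_nonneg]
  apply ENNReal.ofReal_le_ofReal
  change L.envMeasure.real _ ≤ L.envMeasure.real _ * _
  rw [hprod]
  gcongr

theorem setLIntegral_deg {n : ℕ} (hn : 1 ≤ n) (S : Finset (List ℕ)) {u : List ℕ}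
    (hu : u.length = n) (f : ℕ → ℝ≥0∞) :
    ∫⁻ ω in {ω | generation ω n = S}, f (deg ω u) ∂L.envMeasure =
      L.envMeasure {ω | generation ω n = S} * ∑' j, f j * L.sizeBiased j := by
  rw [← lintegral_map (g := fun ω : Env => deg ω u) (f := f) (measurable_of_countable f)
    (measurable_deg u), lintegral_countable', ← ENNReal.tsum_mul_left]
  refine tsum_congr fun j => ?_
  rw [Measure.map_apply (measurable_deg u) (measurableSet_singleton j),
    Measure.restrict_apply (measurable_deg u (measurableSet_singleton j)), inter_comm,
    L.measure_inter_of_disjoint (S := {u | u.length < n}) (T := {u})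
      (F := (fun ω : Env => deg ω u) ⁻¹' {j}) (by simp [hu])
      (determinedBy_generation_eq n S)
      (determinedBy_coord u fun x => x.1 ∈ ({j} : Set ℕ)) (measurableSet_generation_eq n S)
      (measurable_deg u (measurableSet_singleton j))]
  have hu0 : u ≠ [] := by rintro rfl; simp at hu; omega
  have h := L.real_deg u {j}
  rw [Measure.real, Measure.real, ENNReal.toReal_eq_toReal_iff' (measure_ne_top _ _)
    (measure_ne_top _ _), PMF.toMeasure_apply_singleton _ _ (MeasurableSet.of_discrete),
    offspring_of_ne_nil L hu0] at h
  change _ * (_ * L.envMeasure {ω | deg ω u ∈ ({j} : Set ℕ)}) = _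
  rw [h]
  ring

/-- Markov's inequality for the sum of the degrees truncated at `T = z ^ (1/α) e ^ n`: the bound is
`z C T ^ (1-α) / T = C e ^ (-α n)`. -/
theorem measure_fastGrowth_le : ∃ C : ℝ, 0 < C ∧ ∀ n : ℕ, 1 ≤ n →
    L.envMeasure (fastGrowth (τ - 2) n) ≤ ENNReal.ofReal (C * Real.exp (-(τ - 2)) ^ n) := by
  obtain ⟨C, hC, hup⟩ := L.sizeBiased_truncated_mean
  have h2 := L.two_lt
  set α := τ - 2 with hα
  have hα0 : 0 < α := by simp only [hα]; linarith
  refine ⟨C, hC, fun n hn => ?_⟩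
  refine L.measure_le_of_forall_generation n _ _ fun S hS => ?_
  rcases Nat.eq_zero_or_pos S.card with hz0 | hz1
  · have : fastGrowth α n ∩ {ω | generation ω n = S} = ∅ := by
      refine eq_empty_of_forall_notMem fun ω hω => ?_
      have h3 := hω.1.1
      rw [Z, show generation ω n = S from hω.2] at h3
      omega
    simp [this]
  have hz : (1 : ℝ) ≤ S.card := by exact_mod_cast hz1
  set T : ℝ := (S.card : ℝ) ^ (1 / α) * Real.exp n with hT
  have hT1 : 1 ≤ T :=
    one_le_mul_of_one_le_of_one_le (Real.one_le_rpow hz (by positivity))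
      (Real.one_le_exp (by positivity))
  have hT0 : 0 < T := by linarith
  set G : Set Env := {ω | generation ω n = S} with hG
  set f : ℕ → ℝ≥0∞ := fun j => ENNReal.ofReal (min (j : ℝ) T) with hf
  have hsub : fastGrowth α n ∩ G ⊆
      {ω | ENNReal.ofReal T ≤ ∑ u ∈ S, f (deg ω u)} ∩ G := by
    intro ω hω
    refine ⟨?_, hω.2⟩
    have hg : generation ω n = S := hω.2
    have h3 := hω.1.2
    rw [Z, hg] at h3
    have h4 : T < ∑ u ∈ S, (deg ω u : ℝ) := by
      refine h3.trans_le ?_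
      have := Z_succ_le ω n
      rw [hg] at this
      exact_mod_cast this
    have hnn : ∀ u ∈ S, 0 ≤ min (deg ω u : ℝ) T := fun u _ => le_min (by positivity) hT0.le
    simp only [hf, mem_ofPred_eq]
    rw [← ENNReal.ofReal_sum_of_nonneg hnn]
    apply ENNReal.ofReal_le_ofReal
    -- Truncation loses nothing: a single degree above `T` already contributes `T`, and otherwise no
    -- degree is truncated.
    by_cases h5 : ∃ u ∈ S, T ≤ deg ω u
    · obtain ⟨u, hu, h6⟩ := h5
      calc T = min (deg ω u : ℝ) T := (min_eq_right h6).symm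
        _ ≤ _ := Finset.single_le_sum (f := fun u => min (deg ω u : ℝ) T) hnn hu
    · push Not at h5
      rw [Finset.sum_congr rfl fun u hu => min_eq_left (h5 u hu).le]
      exact h4.le
  have hmark : ENNReal.ofReal T * L.envMeasure (fastGrowth α n ∩ G) ≤
      ∫⁻ ω in G, ∑ u ∈ S, f (deg ω u) ∂L.envMeasure := by
    refine le_trans ?_ (mul_meas_ge_le_lintegral
      (Finset.measurable_sum S fun u _ => (measurable_of_countable f).comp (measurable_deg u))
      (ENNReal.ofReal T))
    refine mul_le_mul_right ?_ _
    rw [Measure.restrict_apply' (measurableSet_generation_eq n S)]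
    exact measure_mono hsub
  rw [lintegral_finsetSum (f := fun u ω => f (deg ω u)) _
    fun u _ => (measurable_of_countable f).comp (measurable_deg u)] at hmark
  rw [Finset.sum_congr rfl fun u hu => L.setLIntegral_deg hn S (hS u hu) f, Finset.sum_const,
    nsmul_eq_mul] at hmark
  have hTne : ENNReal.ofReal T ≠ 0 := by simpa using hT0
  have hfin : ENNReal.ofReal T * L.envMeasure (fastGrowth α n ∩ G) ≤
      ENNReal.ofReal T * (L.envMeasure G * ENNReal.ofReal (C * Real.exp (-α) ^ n)) := by
    refine hmark.trans ?_
    calc _ ≤ (S.card : ℝ≥0∞) * (L.envMeasure G * ENNReal.ofReal (C * T ^ (1 - α))) := by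
          gcongr; exact hup T hT1
      _ = L.envMeasure G * (ENNReal.ofReal (S.card * (C * T ^ (1 - α)))) := by
          rw [ENNReal.ofReal_mul (p := (S.card : ℝ)) (by positivity), ENNReal.ofReal_natCast]; ring
      _ = L.envMeasure G * (ENNReal.ofReal (T * (C * Real.exp (-α) ^ n))) := by
          congr 2
          have e : T ^ α = S.card * Real.exp (α * n) := by
            rw [hT, Real.mul_rpow (by positivity) (by positivity), ← Real.rpow_mul (by positivity),
              ← Real.exp_mul, show 1 / α * α = 1 by field_simp, Real.rpow_one, mul_comm α]
          rw [Real.rpow_sub hT0, Real.rpow_one, e, ← Real.exp_nat_mul,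
            show (n : ℝ) * -α = -(α * n) by ring, Real.exp_neg]
          field_simp
      _ = _ := by rw [ENNReal.ofReal_mul hT0.le]; ring
  exact (ENNReal.mul_le_mul_iff_right hTne ENNReal.ofReal_ne_top).1 hfin

theorem ae_eventually_notMem_growth : ∀ᵐ ω ∂L.envMeasure, ∀ᶠ n in atTop,
    ω ∉ slowGrowth (τ - 2) n ∧ ω ∉ fastGrowth (τ - 2) n := by
  have h2 := L.two_lt
  have aux : ∀ s : ℕ → Set Env, (∃ C : ℝ, 0 < C ∧ ∀ n : ℕ, 1 ≤ n →
      L.envMeasure (s n) ≤ ENNReal.ofReal (C * Real.exp (-(τ - 2)) ^ n)) →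
      ∀ᵐ ω ∂L.envMeasure, ∀ᶠ n in atTop, ω ∉ s n := by
    rintro s ⟨C, hC, h⟩
    have hsum : ∑' n, L.envMeasure (s (n + 1)) ≠ ⊤ := by
      have hgeo : Summable fun n : ℕ => C * Real.exp (-(τ - 2)) ^ (n + 1) :=
        (((summable_nat_add_iff 1).2 (summable_geometric_of_lt_one (Real.exp_pos _).le
          (Real.exp_lt_one_iff.2 (by linarith))))).mul_left C
      refine ne_top_of_le_ne_top ?_ (ENNReal.tsum_le_tsum fun n => h (n + 1) (by omega))
      rw [← ENNReal.ofReal_tsum_of_nonneg (fun n => by positivity) hgeo]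
      exact ENNReal.ofReal_ne_top
    filter_upwards [ae_eventually_notMem hsum] with ω hω
    obtain ⟨N, hN⟩ := eventually_atTop.1 hω
    filter_upwards [eventually_ge_atTop (N + 1)] with n hn
    have := hN (n - 1) (by omega)
    rwa [Nat.sub_add_cancel (by omega)] at this
  filter_upwards [aux _ L.measure_slowGrowth_le, aux _ L.measure_fastGrowth_le] with ω h1 h3
  exact h1.and h3

/-- `α ^ (n + 1) log M_n`, where `M_n` is the largest degree in generation `n`. -/
def scaledMaxDeg (τ : ℝ) (n : ℕ) (ω : Env) : ℝ :=
  (τ - 2) ^ (n + 1) * Real.log (maxDeg ω n)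

theorem measurable_scaledMaxDeg (n : ℕ) : Measurable (scaledMaxDeg τ n) :=
  ((Real.measurable_log.comp ((measurable_of_countable (fun k : ℕ => (k : ℝ))).comp
    (measurable_maxDeg n)))).const_mul _

/-- After taking logarithms and scaling, one generation changes `α ^ n log Z_n` by at most `n α ^
n`, which is summable. The maximal degree is squeezed between the same bounds, because `M_n ≤
Z_(n+1)`. -/
theorem tendsto_of_growth {α : ℝ} (h0 : 0 < α) (h1 : α < 1) {ω : Env}
    (hdeg : ∀ u, 1 ≤ deg ω u)
    (hg : ∀ᶠ n in atTop, ω ∉ slowGrowth α n ∧ ω ∉ fastGrowth α n) :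
    ∃ y : ℝ, Tendsto (fun n : ℕ => α ^ n * Real.log (Z ω n)) atTop (𝓝 y) ∧
      Tendsto (fun n : ℕ => α ^ (n + 1) * Real.log (maxDeg ω n)) atTop (𝓝 y) := by
  have hZ : ∀ n, (1 : ℝ) ≤ Z ω n := fun n => by exact_mod_cast Z_pos hdeg n
  have hM : ∀ n, (1 : ℝ) ≤ maxDeg ω n := fun n => by
    obtain ⟨u, hu⟩ := Finset.card_pos.1 (Z_pos hdeg n)
    exact_mod_cast (hdeg u).trans (deg_le_maxDeg hu)
  set y : ℕ → ℝ := fun n => α ^ n * Real.log (Z ω n) with hy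
  set X : ℕ → ℝ := fun n => α ^ (n + 1) * Real.log (maxDeg ω n) with hX
  have hXy : ∀ n, X n ≤ y (n + 1) := fun n => by
    refine mul_le_mul_of_nonneg_left (Real.log_le_log (by linarith [hM n]) ?_) (by positivity)
    exact_mod_cast maxDeg_le_Z ω n
  have hbound : ∀ᶠ n : ℕ in atTop, y n - (n : ℝ) * α ^ n ≤ X n ∧ y (n + 1) ≤ y n + n * α ^ n := by
    filter_upwards [hg] with n hn
    have hlog : Real.log ((Z ω n : ℝ) ^ (1 / α)) = Real.log (Z ω n) / α := by
      rw [Real.log_rpow (by linarith [hZ n])]; ring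
    have hpos : 0 < (Z ω n : ℝ) ^ (1 / α) := by have := hZ n; positivity
    have hle : (n : ℝ) * α ^ (n + 1) ≤ n * α ^ n := by
      gcongr ?_ * ?_
      exact pow_le_pow_of_le_one h0.le h1.le (Nat.le_succ n)
    constructor
    · have h2 : (Z ω n : ℝ) ^ (1 / α) * Real.exp (-n) ≤ maxDeg ω n := by
        by_contra hlt
        push Not at hlt
        refine hn.1 ⟨(hM n).trans hlt.le, fun u hu => lt_of_le_of_lt ?_ hlt⟩
        exact_mod_cast deg_le_maxDeg hu
      have h3 := Real.log_le_log (by positivity) h2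
      rw [Real.log_mul hpos.ne' (Real.exp_pos _).ne', hlog, Real.log_exp] at h3
      have h4 := mul_le_mul_of_nonneg_left h3 (by positivity : 0 ≤ α ^ (n + 1))
      have h5 : α ^ (n + 1) * (Real.log (Z ω n) / α + -n) = y n - n * α ^ (n + 1) := by
        simp only [hy]; field_simp; ring
      simp only [hX]
      linarith
    · have h2 : (Z ω (n + 1) : ℝ) ≤ (Z ω n : ℝ) ^ (1 / α) * Real.exp n := by
        by_contra hlt
        push Not at hlt
        exact hn.2 ⟨Z_pos hdeg n, hlt⟩
      have h3 := Real.log_le_log (by linarith [hZ (n + 1)]) h2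
      rw [Real.log_mul hpos.ne' (Real.exp_pos _).ne', hlog, Real.log_exp] at h3
      have h4 := mul_le_mul_of_nonneg_left h3 (by positivity : 0 ≤ α ^ (n + 1))
      have h5 : α ^ (n + 1) * (Real.log (Z ω n) / α + n) = y n + n * α ^ (n + 1) := by
        simp only [hy]; field_simp; ring
      change α ^ (n + 1) * Real.log (Z ω (n + 1)) ≤ _
      linarith
  have hsum : Summable fun n : ℕ => (n : ℝ) * α ^ n := by
    simpa using summable_pow_mul_geometric_of_norm_lt_one 1
      (show ‖α‖ < 1 by rwa [Real.norm_eq_abs, abs_of_pos h0])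
  have hcauchy : CauchySeq y := by
    refine cauchySeq_of_summable_dist (Summable.of_norm_bounded_eventually_nat hsum ?_)
    filter_upwards [hbound] with n hn
    rw [Real.norm_eq_abs, abs_of_nonneg dist_nonneg, Real.dist_eq, abs_le]
    have h2 : y n.succ = y (n + 1) := rfl
    rw [h2]
    constructor <;> linarith [hn.1, hn.2, hXy n]
  obtain ⟨l, hl⟩ := cauchySeq_tendsto_of_complete hcauchy
  refine ⟨l, hl, ?_⟩
  have hl1 : Tendsto (fun n => y (n + 1)) atTop (𝓝 l) := (tendsto_add_atTop_iff_nat 1).2 hl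
  have hl2 : Tendsto (fun n : ℕ => y n - (n : ℝ) * α ^ n) atTop (𝓝 l) := by
    simpa using hl.sub hsum.tendsto_atTop_zero
  exact tendsto_of_tendsto_of_tendsto_of_le_of_le' hl2 hl1 (hbound.mono fun n hn => hn.1)
    (Eventually.of_forall hXy)

/-- The double-exponential growth limit exists almost surely, also along the maximal degrees. -/
theorem exists_growth_limit : ∃ Y : Env → ℝ, Measurable Y ∧ L.lawY = L.envMeasure.map Y ∧
    ∀ᵐ ω ∂L.envMeasure, Tendsto (fun n => scaledMaxDeg τ n ω) atTop (𝓝 (Y ω)) := by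
  have h2 := L.two_lt
  have h3 := L.lt_three
  have key : ∀ᵐ ω ∂L.envMeasure,
      Tendsto (fun n : ℕ => (τ - 2) ^ n * Real.log (Z ω n)) atTop (𝓝 (limitY τ ω)) ∧
      Tendsto (fun n => scaledMaxDeg τ n ω) atTop (𝓝 (limitY τ ω)) := by
    filter_upwards [L.ae_one_le_deg, L.ae_eventually_notMem_growth] with ω hdeg hg
    obtain ⟨y, hy1, hy2⟩ := tendsto_of_growth (by linarith) (by linarith) hdeg hg
    have e : limitY τ ω = y := hy1.limUnder_eq
    rw [e]
    exact ⟨hy1, hy2⟩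
  -- `limitY` is only known to be an almost sure limit of measurable functions, so the witness `Y`
  -- is a measurable modification of it with the same law.
  have hae : AEMeasurable (limitY τ) L.envMeasure :=
    aemeasurable_of_tendsto_metrizable_ae atTop
      (fun n => (measurable_scaledMaxDeg (τ := τ) n).aemeasurable) (key.mono fun ω h => h.2)
  refine ⟨hae.mk _, hae.measurable_mk, Measure.map_congr hae.ae_eq_mk, ?_⟩
  filter_upwards [key, hae.ae_eq_mk] with ω h h'
  rw [← h']
  exact h.2

end DegreeLaw

/-! ### Masses of balls on compact spaces and on the circle. -/

section CompactMeasure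

variable {X : Type*} [PseudoMetricSpace X] [MeasurableSpace X]

/-- Finitely many balls of radius `r / 2` cover `S`, and every ball of radius `r` centred in `S`
contains one of them. -/
theorem exists_forall_le_measureReal_ball (ν : Measure X) [IsFiniteMeasure ν] {S : Set X}
    (hS : IsCompact S) {r : ℝ} (hr : 0 < r) (hpos : ∀ x ∈ S, ∀ s > 0, 0 < ν (Metric.ball x s)) :
    ∃ p : ℝ, 0 < p ∧ ∀ x ∈ S, p ≤ ν.real (Metric.ball x r) := by
  obtain ⟨t, htS, hfin, hcov⟩ := hS.finite_cover_balls (half_pos hr)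
  rcases t.eq_empty_or_nonempty with rfl | hne
  · refine ⟨1, one_pos, fun x hx => ?_⟩
    have := hcov hx
    simp at this
  obtain ⟨y, hy, hmin⟩ := hfin.exists_minimalFor (fun y => ν.real (Metric.ball y (r / 2))) t hne
  refine ⟨ν.real (Metric.ball y (r / 2)),
    ENNReal.toReal_pos (hpos y (htS hy) _ (half_pos hr)).ne' (measure_ne_top _ _), fun x hx => ?_⟩
  obtain ⟨z, hz, hxz⟩ := mem_iUnion₂.1 (hcov hx)
  have h1 : ν.real (Metric.ball y (r / 2)) ≤ ν.real (Metric.ball z (r / 2)) := by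
    rcases le_total (ν.real (Metric.ball y (r / 2))) (ν.real (Metric.ball z (r / 2))) with h | h
    · exact h
    · exact hmin hz h
  refine h1.trans (measureReal_mono fun w hw => ?_)
  rw [Metric.mem_ball] at *
  have := dist_triangle w z x
  rw [dist_comm z x] at this
  linarith

/-- Continuity from above gives each point a ball of small mass; a Lebesgue number of this cover
makes the radius uniform. -/
theorem exists_forall_measureReal_closedBall_le [CompactSpace X] [OpensMeasurableSpace X]
    (ν : Measure X) [IsFiniteMeasure ν]
    (hatom : ∀ x, ν (Metric.closedBall x 0) = 0) {ε : ℝ} (hε : 0 < ε) :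
    ∃ r : ℝ, 0 < r ∧ ∀ x, ν.real (Metric.closedBall x r) ≤ ε := by
  have h1 : ∀ x, ∃ r : ℝ, 0 < r ∧ ν.real (Metric.ball x r) ≤ ε := by
    intro x
    have hlim := tendsto_measure_iInter_atTop (μ := ν)
      (s := fun n : ℕ => Metric.closedBall x (1 / ((n : ℝ) + 1)))
      (fun n => Metric.isClosed_closedBall.measurableSet.nullMeasurableSet)
      (fun m n hmn => Metric.closedBall_subset_closedBall (by gcongr)) ⟨0, measure_ne_top _ _⟩
    have hInter : (⋂ n : ℕ, Metric.closedBall x (1 / ((n : ℝ) + 1))) ⊆ Metric.closedBall x 0 := by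
      intro y hy
      rw [Metric.mem_closedBall]
      exact ge_of_tendsto' tendsto_one_div_add_atTop_nhds_zero_nat fun n => mem_iInter.1 hy n
    rw [measure_mono_null hInter (hatom x)] at hlim
    obtain ⟨n, hn⟩ := (hlim.eventually (ge_mem_nhds (ENNReal.ofReal_pos.2 hε))).exists
    refine ⟨1 / ((n : ℝ) + 1), by positivity, ?_⟩
    refine ENNReal.toReal_le_of_le_ofReal hε.le ?_
    exact (measure_mono Metric.ball_subset_closedBall).trans hn
  choose r hr hν using h1
  obtain ⟨δ, hδ, hleb⟩ := lebesgue_number_lemma_of_metric (isCompact_univ (X := X))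
    (c := fun x => Metric.ball x (r x)) (fun _ => Metric.isOpen_ball)
    (fun x _ => mem_iUnion.2 ⟨x, Metric.mem_ball_self (hr x)⟩)
  refine ⟨δ / 2, half_pos hδ, fun x => ?_⟩
  obtain ⟨y, hy⟩ := hleb x trivial
  exact (measureReal_mono ((Metric.closedBall_subset_ball (half_lt_self hδ)).trans hy)).trans (hν y)

/-- The largest mass of a closed ball of radius `w`. -/
def ballSup (ν : Measure X) (w : ℝ) : ℝ := ⨆ x, ν.real (Metric.closedBall x w)

theorem ballSup_nonneg (ν : Measure X) (w : ℝ) : 0 ≤ ballSup ν w :=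
  Real.iSup_nonneg fun _ => measureReal_nonneg

variable (ν : Measure X) [IsProbabilityMeasure ν]

theorem bddAbove_ball (w : ℝ) : BddAbove (range fun x => ν.real (Metric.closedBall x w)) :=
  ⟨1, by rintro _ ⟨x, rfl⟩; exact measureReal_le_one⟩

theorem le_ballSup (x : X) (w : ℝ) : ν.real (Metric.closedBall x w) ≤ ballSup ν w :=
  le_ciSup (bddAbove_ball ν w) x

theorem ballSup_mono [Nonempty X] : Monotone (ballSup ν) := fun _ _ h =>
  ciSup_mono (bddAbove_ball ν _) fun _ => measureReal_mono (Metric.closedBall_subset_closedBall h)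

end CompactMeasure

section Circle

variable {a : ℝ} (ν : Measure (AddCircle a)) [IsProbabilityMeasure ν]

/-- A closed arc of radius `w < a / 2` misses the arc of radius `a / 2 - w` around the antipode of
its centre, and by compactness such arcs have mass bounded below. -/
theorem ballSup_lt_one (ha : 0 < a) (hpos : ∀ x : AddCircle a, ∀ s > 0, 0 < ν (Metric.ball x s))
    {w : ℝ} (hw : w < a / 2) : ballSup ν w < 1 := by
  have : Fact (0 < a) := ⟨ha⟩
  obtain ⟨p, hp, hle⟩ := exists_forall_le_measureReal_ball ν (isCompact_univ (X := AddCircle a))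
    (sub_pos.2 hw) fun x _ => hpos x
  have h : ballSup ν w ≤ 1 - p := by
    refine ciSup_le fun x => ?_
    have hsub : Metric.closedBall x w ⊆
        (Metric.ball (x + ((a / 2 : ℝ) : AddCircle a)) (a / 2 - w))ᶜ := by
      intro y hy hy'
      rw [Metric.mem_closedBall] at hy
      rw [Metric.mem_ball] at hy'
      have h1 := dist_triangle_left (x + ((a / 2 : ℝ) : AddCircle a)) x y
      rw [dist_eq_norm, add_sub_cancel_left, AddCircle.norm_half_period_eq, abs_of_pos ha] at h1
      linarith
    have h2 := measureReal_mono (μ := ν) hsub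
    rw [probReal_compl_eq_one_sub Metric.isOpen_ball.measurableSet] at h2
    linarith [hle (x + ((a / 2 : ℝ) : AddCircle a)) trivial]
  linarith

theorem tendsto_ballSup_zero (ha : 0 < a) (hatom : ∀ x : AddCircle a, ν {x} = 0) :
    Tendsto (ballSup ν) (𝓝 0) (𝓝 0) := by
  have : Fact (0 < a) := ⟨ha⟩
  refine Metric.tendsto_nhds.2 fun ε hε => ?_
  obtain ⟨r, hr, h⟩ := exists_forall_measureReal_closedBall_le ν
    (fun x => by rw [Metric.closedBall_zero]; exact hatom x) (half_pos hε)
  filter_upwards [gt_mem_nhds hr] with w hw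
  rw [Real.dist_eq, sub_zero, abs_of_nonneg (ballSup_nonneg ν w)]
  have h1 : ballSup ν r ≤ ε / 2 := ciSup_le h
  linarith [ballSup_mono ν hw.le]

end Circle

/-- If almost surely eventually `ω ∈ A n`, then with high probability `ω ∈ A n` for all `n ≥ N`. -/
theorem exists_measureReal_iUnion_compl_le {Ω : Type*} [MeasurableSpace Ω] (μ : Measure Ω)
    [IsFiniteMeasure μ] {A : ℕ → Set Ω} (mA : ∀ n, MeasurableSet (A n))
    (hA : ∀ᵐ ω ∂μ, ∀ᶠ n in atTop, ω ∈ A n) {η : ℝ} (hη : 0 < η) :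
    ∃ N₀ : ℕ, ∀ N ≥ N₀, μ.real {ω | ∃ n ≥ N, ω ∉ A n} ≤ η := by
  have hset : ∀ N, {ω | ∃ n ≥ N, ω ∉ A n} = ⋃ n, ⋃ _ : n ≥ N, (A n)ᶜ := by
    intro N; ext ω; simp
  have hanti : Antitone fun N : ℕ => {ω | ∃ n ≥ N, ω ∉ A n} :=
    fun M N hMN ω ⟨n, hn, h⟩ => ⟨n, hMN.trans hn, h⟩
  have hlim := tendsto_measure_iInter_atTop (μ := μ) (s := fun N : ℕ => {ω | ∃ n ≥ N, ω ∉ A n})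
    (fun N => by
      rw [hset]
      exact (MeasurableSet.iUnion fun n => MeasurableSet.iUnion fun _ =>
        (mA n).compl).nullMeasurableSet) hanti ⟨0, measure_ne_top _ _⟩
  have hnull : μ (⋂ N : ℕ, {ω | ∃ n ≥ N, ω ∉ A n}) = 0 := by
    refine measure_mono_null (fun ω hω => ?_) (ae_iff.1 hA)
    intro h
    obtain ⟨N, hN⟩ := eventually_atTop.1 h
    obtain ⟨n, hn, h'⟩ := mem_iInter.1 hω N
    exact h' (hN n hn)
  rw [hnull] at hlim
  obtain ⟨N₀, hN₀⟩ := (hlim.eventually (ge_mem_nhds (ENNReal.ofReal_pos.2 hη))).exists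
  refine ⟨N₀, fun N hN => ENNReal.toReal_le_of_le_ofReal hη.le ?_⟩
  exact (measure_mono (hanti hN)).trans hN₀

/-! ### The upper bound. -/

namespace BranchingTree

open DegreeLaw

theorem exists_of_flowColour_eq_blue {S : Set Colour} {b : Bool}
    (h : flowColour S b = Colour.blue) : Colour.blue ∈ S := by
  unfold flowColour at h
  split_ifs at h with h1
  · exact h1.2
  · assumption

/-- A blue individual has a blue child, so blue can be traced down to the last generation, where it
requires degree at least `Q ^ γ`. -/
theorem exists_deg_of_colour_eq_blue {τ γ Q : ℝ} {ω : Env} {r j : ℕ} {u : List ℕ}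
    (hu : u ∈ generation ω j) (h : colour τ γ Q ω r u = Colour.blue) :
    ∃ v ∈ generation ω (j + r), Q ^ γ ≤ deg ω v := by
  induction r generalizing u j with
  | zero =>
    refine ⟨u, hu, ?_⟩
    simp only [colour, startColour] at h
    split_ifs at h with h1 h2
    exact h2.1
  | succ r ih =>
    obtain ⟨i, hi, h1⟩ := exists_of_flowColour_eq_blue h
    obtain ⟨v, hv, h2⟩ := ih ((cons_mem_generation ω j i u).2 ⟨hu, hi⟩) h1
    exact ⟨v, by rwa [show j + (r + 1) = j + 1 + r by ring], h2⟩

end BranchingTree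

namespace DegreeLaw

open BranchingTree

variable {τ : ℝ} (L : DegreeLaw τ)

/-- Finitely many finite maxima are tight. In the appeal to `exists_measureReal_iUnion_compl_le` the
index is the degree level, not the generation. -/
theorem exists_forall_measureReal_maxDeg_le (N : ℕ) {η : ℝ} (hη : 0 < η) :
    ∀ᶠ Q : ℝ in atTop, L.envMeasure.real {ω | ∃ m ≤ N, Q ≤ (maxDeg ω m : ℝ)} ≤ η := by
  obtain ⟨j, hj⟩ := exists_measureReal_iUnion_compl_le L.envMeasure
    (A := fun n => {ω | ∀ m ≤ N, maxDeg ω m < n})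
    (fun n => by
      have : {ω : Env | ∀ m ≤ N, maxDeg ω m < n} = ⋂ m, ⋂ _ : m ≤ N, {ω | maxDeg ω m < n} := by
        ext; simp
      rw [this]
      exact MeasurableSet.iInter fun m => MeasurableSet.iInter fun _ =>
        measurable_maxDeg m (MeasurableSet.of_discrete (s := {k | k < n})))
    (Eventually.of_forall fun ω => by
      filter_upwards [eventually_gt_atTop ((Finset.range (N + 1)).sup fun m => maxDeg ω m)]
        with n hn m hm
      exact lt_of_le_of_lt (Finset.le_sup (f := fun m => maxDeg ω m)
        (Finset.mem_range.2 (by omega))) hn) hη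
  filter_upwards [eventually_ge_atTop (j : ℝ)] with Q hQ
  refine le_trans (measureReal_mono ?_) (hj j le_rfl)
  rintro ω ⟨m, hm, h⟩
  refine ⟨j, le_rfl, fun h' => ?_⟩
  have h1 : (maxDeg ω m : ℝ) < j := by exact_mod_cast h' m hm
  linarith

theorem probRootBlue_le {Y : Env → ℝ} (mY : Measurable Y)
    (hpos : ∀ᵐ ω ∂L.envMeasure, 0 < Y ω)
    (hlim : ∀ᵐ ω ∂L.envMeasure, Tendsto (fun n => scaledMaxDeg τ n ω) atTop (𝓝 (Y ω)))
    {γ : ℝ} (hγ : 1 < γ) {δ η : ℝ} (hδ : 0 < δ) (hη : 0 < η) :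
    ∀ᶠ Q : ℝ in atTop, L.probRootBlue γ Q ≤
      ballSup (L.envMeasure.map fun ω => (Real.log (Y ω) : AddCircle (-Real.log (τ - 2))))
        ((-Real.log (τ - 2) - Real.log γ) / 2 + δ) + η := by
  have h2 := L.two_lt
  set α := τ - 2 with hα
  have hα0 : 0 < α := by simp only [hα]; linarith
  set a := -Real.log α with ha
  have mV : Measurable fun ω => (Real.log (Y ω) : AddCircle a) :=
    (AddCircle.continuous_mk' a).measurable.comp (Real.measurable_log.comp mY)
  have : IsProbabilityMeasure (L.envMeasure.map fun ω => (Real.log (Y ω) : AddCircle a)) :=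
    Measure.isProbabilityMeasure_map mV.aemeasurable
  -- The error is multiplicative, so that it becomes an additive `δ` for `log Y`.
  set A : ℕ → Set Env := fun n => {ω | 0 < Y ω ∧ Real.exp (-δ) * Y ω ≤ scaledMaxDeg τ n ω ∧
    scaledMaxDeg τ n ω ≤ Real.exp δ * Y ω} with hA
  have mA : ∀ n, MeasurableSet (A n) := fun n =>
    (measurableSet_lt measurable_const mY).inter
      ((measurableSet_le (mY.const_mul _) (measurable_scaledMaxDeg n)).inter
        (measurableSet_le (measurable_scaledMaxDeg n) (mY.const_mul _)))
  have hAev : ∀ᵐ ω ∂L.envMeasure, ∀ᶠ n in atTop, ω ∈ A n := by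
    filter_upwards [hpos, hlim] with ω h0 hl
    have e1 : Real.exp (-δ) * Y ω < Y ω := by
      have : Real.exp (-δ) < 1 := Real.exp_lt_one_iff.2 (by linarith)
      nlinarith
    have e2 : Y ω < Real.exp δ * Y ω := by
      have : 1 < Real.exp δ := Real.one_lt_exp_iff.2 hδ
      nlinarith
    filter_upwards [hl.eventually (lt_mem_nhds e1), hl.eventually (gt_mem_nhds e2)] with n h3 h4
    exact ⟨h0, h3.le, h4.le⟩
  obtain ⟨N, hN⟩ := exists_measureReal_iUnion_compl_le L.envMeasure mA hAev (half_pos hη)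
  have hN := hN N le_rfl
  filter_upwards [L.exists_forall_measureReal_maxDeg_le N (half_pos hη),
    eventually_gt_atTop (1 : ℝ)] with Q hQ hQ1
  have hℓ : 0 < Real.log Q := Real.log_pos hQ1
  -- Modulo `a`, this is the midpoint of the interval from `log log Q + log γ - a` to `log log Q`.
  obtain ⟨c, hc⟩ : ∃ c : ℝ, c = Real.log (Real.log Q) + (Real.log γ - a) / 2 := ⟨_, rfl⟩
  have hsub : {ω | rootColour τ γ Q ω = Colour.blue} ⊆
      ((fun ω => (Real.log (Y ω) : AddCircle a)) ⁻¹'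
        Metric.closedBall (c : AddCircle a) ((a - Real.log γ) / 2 + δ)) ∪
      ({ω | ∃ n ≥ N, ω ∉ A n} ∪ {ω | ∃ m ≤ N, Q ≤ (maxDeg ω m : ℝ)}) := by
    intro ω hω
    by_contra hcon
    simp only [mem_union, not_or] at hcon
    obtain ⟨hball, hgood, hsmall⟩ := hcon
    simp only [mem_ofPred_eq, not_exists, not_and, not_not, not_le] at hgood hsmall
    apply hball
    obtain ⟨v, hv, hdeg⟩ := exists_deg_of_colour_eq_blue (j := 0)
      ((mem_generation_zero ω []).2 rfl) (show colour τ γ Q ω (stopGen ω Q) [] = _ from hω)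
    rw [zero_add] at hv
    have hM : Q ^ γ ≤ maxDeg ω (stopGen ω Q) :=
      hdeg.trans (by exact_mod_cast deg_le_maxDeg hv)
    have hQγ : Q ≤ Q ^ γ := by
      calc Q = Q ^ (1 : ℝ) := (Real.rpow_one Q).symm
        _ ≤ Q ^ γ := Real.rpow_le_rpow_of_exponent_le hQ1.le hγ.le
    have hκ : N < stopGen ω Q := by
      by_contra h
      push Not at h
      linarith [hsmall _ h]
    obtain ⟨m, hm⟩ : ∃ m, stopGen ω Q = m + 1 := ⟨stopGen ω Q - 1, by omega⟩
    have hMm : (maxDeg ω m : ℝ) ≤ Q := by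
      have h3 : m ∉ {j : ℕ | ∃ u ∈ generation ω j, Q ≤ (deg ω u : ℝ)} :=
        Nat.notMem_of_lt_sInf (by change m < stopGen ω Q; omega)
      rcases (generation ω m).eq_empty_or_nonempty with h4 | h4
      · simp [maxDeg, h4]; linarith
      · obtain ⟨u, hu, h5⟩ := exists_deg_eq_maxDeg h4
        by_contra h6
        push Not at h6
        exact h3 ⟨u, hu, by rw [h5]; exact h6.le⟩
    rw [hm] at hM hκ
    obtain ⟨hY0, -, hup⟩ := hgood (m + 1) (by omega)
    obtain ⟨-, hlow, -⟩ := hgood m (by omega)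
    have hM0 : (0 : ℝ) < maxDeg ω m := by
      rcases Nat.eq_zero_or_pos (maxDeg ω m) with h3 | h3
      · simp only [scaledMaxDeg, h3] at hlow
        simp at hlow
        have : 0 < Real.exp (-δ) * Y ω := by positivity
        linarith
      · exact_mod_cast h3
    -- Generation `m = κ - 1` bounds `Y` from above and generation `m + 1 = κ` bounds it from below.
    -- The two bounds differ by the factor `γ α`, up to `e ^ (±δ)`.
    have u1 : Real.exp (-δ) * Y ω ≤ α ^ (m + 1) * Real.log Q :=
      hlow.trans (mul_le_mul_of_nonneg_left (Real.log_le_log hM0 hMm) (by positivity))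
    have u2 : α ^ (m + 2) * (γ * Real.log Q) ≤ Real.exp δ * Y ω := by
      refine le_trans (mul_le_mul_of_nonneg_left ?_ (by positivity)) hup
      rw [← Real.log_rpow (by linarith)]
      exact Real.log_le_log (by positivity) hM
    have v1 := Real.log_le_log (by positivity) u1
    have v2 := Real.log_le_log (by positivity) u2
    rw [Real.log_mul (by positivity) hY0.ne', Real.log_mul (by positivity) hℓ.ne', Real.log_exp,
      Real.log_pow] at v1
    rw [Real.log_mul (by positivity) (by positivity), Real.log_mul (by positivity) hℓ.ne',
      Real.log_mul (by positivity) hY0.ne', Real.log_exp, Real.log_pow] at v2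
    have hla : Real.log α = -a := by simp [ha]
    rw [hla] at v1 v2
    push_cast at v1 v2
    rw [mem_preimage, Metric.mem_closedBall, dist_eq_norm]
    -- Adding `m + 1` periods removes the dependence on the random generation.
    have e : (Real.log (Y ω) : AddCircle a) - (c : AddCircle a) =
        ((Real.log (Y ω) - c + (m + 1 : ℕ) * a : ℝ) : AddCircle a) := by
      have h3 : (((m + 1 : ℕ) * a : ℝ) : AddCircle a) = 0 := by
        exact (QuotientAddGroup.eq_zero_iff _).2 ⟨((m + 1 : ℕ) : ℤ), by simp⟩
      rw [AddCircle.coe_add, h3, add_zero, AddCircle.coe_sub]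
    rw [e]
    refine (QuotientAddGroup.norm_mk_le_norm (S := AddSubgroup.zmultiples a)).trans ?_
    rw [Real.norm_eq_abs, abs_le, hc]
    push_cast
    constructor <;> nlinarith
  have h3 := (measureReal_mono (μ := L.envMeasure) hsub).trans ((measureReal_union_le _ _).trans
    (add_le_add le_rfl (measureReal_union_le _ _)))
  rw [← map_measureReal_apply mV Metric.isClosed_closedBall.measurableSet] at h3
  have h4 := le_ballSup (L.envMeasure.map fun ω => (Real.log (Y ω) : AddCircle a))
    (c : AddCircle a) ((a - Real.log γ) / 2 + δ)
  unfold probRootBlue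
  linarith

end DegreeLaw

/-! ### Open paths, coin flips and the cost of a blue root. -/

namespace BranchingTree

open DegreeLaw

/-- There is a path from `u` to a descendant `r` generations later all of whose coins show `true`
and whose last individual is one that may be painted blue by the starting rule. -/
def OpenPath (τ γ Q : ℝ) (ω : Env) : ℕ → List ℕ → Prop
  | 0, u => coin ω u = true ∧ Q ^ γ ≤ (deg ω u : ℝ) ∧ (deg ω u : ℝ) < Q ^ (1 / (τ - 2))
  | r + 1, u => coin ω u = true ∧ ∃ i < deg ω u, OpenPath τ γ Q ω r (i :: u)

variable {τ γ Q : ℝ}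

/-- Along the path each individual has a blue child, and its coin decides for blue if a red child
competes; nothing else about the tree matters. -/
theorem OpenPath.colour_eq_blue {ω : Env} {r : ℕ} {u : List ℕ} (h : OpenPath τ γ Q ω r u) :
    colour τ γ Q ω r u = Colour.blue := by
  induction r generalizing u with
  | zero =>
    obtain ⟨h1, h2, h3⟩ := h
    simp only [colour, startColour]
    rw [if_neg (fun h => absurd h.2 (not_lt.2 h2)), if_pos ⟨h2, h3⟩, if_pos h1]
  | succ r ih =>
    obtain ⟨h1, i, hi, h2⟩ := h
    have hb : Colour.blue ∈ {a | ∃ i < deg ω u, colour τ γ Q ω r (i :: u) = a} := ⟨i, hi, ih h2⟩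
    simp only [colour, flowColour]
    split_ifs with h3 h4
    · rfl
    · exact absurd ⟨h4, hb⟩ h3
    · rfl

theorem OpenPath.exists_deg {ω : Env} {r j : ℕ} {u : List ℕ} (hu : u ∈ generation ω j)
    (h : OpenPath τ γ Q ω r u) : ∃ v ∈ generation ω (j + r), Q ^ γ ≤ deg ω v :=
  exists_deg_of_colour_eq_blue hu h.colour_eq_blue

theorem OpenPath.from_root {ω : Env} {k s : ℕ} {v : List ℕ} (hv : v ∈ generation ω k)
    (hcoin : ∀ w, w <:+ v → coin ω w = true) (h : OpenPath τ γ Q ω s v) :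
    OpenPath τ γ Q ω (k + s) [] := by
  induction k generalizing v s with
  | zero =>
    rw [(mem_generation_zero ω v).1 hv] at h
    simpa using h
  | succ k ih =>
    cases v with
    | nil => exact absurd hv (nil_notMem_generation ω k)
    | cons i u =>
      have h1 := (cons_mem_generation ω k i u).1 hv
      rw [show k + 1 + s = k + (s + 1) by ring]
      exact ih h1.1 (fun w hw => hcoin w (hw.trans (List.suffix_cons i u)))
        ⟨hcoin u (List.suffix_cons i u), i, h1.2, h⟩

theorem measurableSet_coin (u : List ℕ) : MeasurableSet {ω : Env | coin ω u = true} :=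
  measurable_coin u (measurableSet_singleton true)

theorem measurableSet_openPath (r : ℕ) (u : List ℕ) :
    MeasurableSet {ω : Env | OpenPath τ γ Q ω r u} := by
  induction r generalizing u with
  | zero =>
    exact (measurableSet_coin u).inter
      (measurableSet_deg u fun d => Q ^ γ ≤ (d : ℝ) ∧ (d : ℝ) < Q ^ (1 / (τ - 2)))
  | succ r ih =>
    have h : {ω : Env | OpenPath τ γ Q ω (r + 1) u} = {ω | coin ω u = true} ∩
        ⋃ i, ({ω | i < deg ω u} ∩ {ω | OpenPath τ γ Q ω r (i :: u)}) := by
      ext ω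
      simp [OpenPath]
    rw [h]
    exact (measurableSet_coin u).inter (MeasurableSet.iUnion fun i =>
      (measurableSet_deg u fun d => i < d).inter (ih (i :: u)))

/-- The descendants of `u`, with `u` included, are the words having `u` as a suffix. Distinct
siblings therefore carry independent open-path events. -/
theorem determinedBy_openPath (r : ℕ) (u : List ℕ) :
    DeterminedBy {w | u <:+ w} {ω : Env | OpenPath τ γ Q ω r u} := by
  intro ω ω' h
  induction r generalizing u with
  | zero => simp only [mem_ofPred_eq, OpenPath, coin, deg, h u List.suffix_rfl]
  | succ r ih =>
    have h1 : ∀ i, OpenPath τ γ Q ω r (i :: u) ↔ OpenPath τ γ Q ω' r (i :: u) := fun i =>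
      ih (i :: u) fun w hw => h w ((List.suffix_cons i u).trans hw)
    simp only [mem_ofPred_eq, OpenPath, coin, deg, h u List.suffix_rfl, h1]

end BranchingTree

namespace DegreeLaw

open BranchingTree

/-- The part of `E v` that is not contained in an `E w` with an earlier `w`. -/
def firstOf (E : List ℕ → Set Env) (v : List ℕ) : Set Env :=
  E v \ ⋃ w, ⋃ _ : Encodable.encode w < Encodable.encode v, E w

theorem firstOf_subset (E : List ℕ → Set Env) (v : List ℕ) : firstOf E v ⊆ E v := sdiff_subset

theorem iUnion_subset_iUnion_firstOf (E : List ℕ → Set Env) : ⋃ v, E v ⊆ ⋃ v, firstOf E v := by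
  classical
  intro ω hω
  have hex : ∃ n : ℕ, ∃ v : List ℕ, Encodable.encode v = n ∧ ω ∈ E v := by
    obtain ⟨v, hv⟩ := mem_iUnion.1 hω
    exact ⟨_, v, rfl, hv⟩
  obtain ⟨v, hv, hE⟩ := Nat.find_spec hex
  refine mem_iUnion.2 ⟨v, hE, fun h => ?_⟩
  obtain ⟨w, hw, hw'⟩ := mem_iUnion₂.1 h
  rw [hv] at hw
  exact Nat.find_min hex hw ⟨w, rfl, hw'⟩

theorem pairwise_disjoint_firstOf (E : List ℕ → Set Env) : Pairwise (Function.onFun Disjoint (firstOf E)) := by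
  intro v w hvw
  refine Set.disjoint_left.2 fun ω hv hw => ?_
  rcases lt_trichotomy (Encodable.encode v) (Encodable.encode w) with h | h | h
  · exact hw.2 (mem_iUnion₂.2 ⟨v, h, hv.1⟩)
  · exact hvw (Encodable.encode_injective h)
  · exact hv.2 (mem_iUnion₂.2 ⟨w, h, hw.1⟩)

theorem measurableSet_firstOf {E : List ℕ → Set Env} (hE : ∀ v, MeasurableSet (E v))
    (v : List ℕ) : MeasurableSet (firstOf E v) :=
  (hE v).diff (MeasurableSet.iUnion fun w => MeasurableSet.iUnion fun _ => hE w)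

theorem mem_firstOf_congr {E : List ℕ → Set Env} {ω ω' : Env}
    (h : ∀ v, ω ∈ E v ↔ ω' ∈ E v) (v : List ℕ) : ω ∈ firstOf E v ↔ ω' ∈ firstOf E v := by
  simp only [firstOf, Set.mem_sdiff, mem_iUnion, h]

theorem hasSum_measureReal_firstOf (μ : Measure Env) [IsFiniteMeasure μ] {E : List ℕ → Set Env}
    (hE : ∀ v, MeasurableSet (E v)) :
    HasSum (fun v => μ.real (firstOf E v)) (μ.real (⋃ v, E v)) := by
  have h : ⋃ v, E v = ⋃ v, firstOf E v := subset_antisymm (iUnion_subset_iUnion_firstOf E)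
    (iUnion_mono (firstOf_subset E))
  rw [h]
  have h1 := measure_iUnion (μ := μ) (pairwise_disjoint_firstOf E) (measurableSet_firstOf hE)
  have h2 : ∑' v, μ (firstOf E v) ≠ ⊤ := h1 ▸ measure_ne_top _ _
  rw [Measure.real, h1, ENNReal.tsum_toReal_eq fun v => measure_ne_top _ _]
  exact (ENNReal.summable_toReal h2).hasSum

/-- Flip the coin of the individual `w`. -/
def flip (w : List ℕ) (ω : Env) : Env :=
  fun u => if u = w then ((ω u).1, !(ω u).2) else ω u

theorem deg_flip (w u : List ℕ) (ω : Env) : deg (flip w ω) u = deg ω u := by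
  unfold deg flip; split_ifs <;> rfl

theorem coin_flip_self (w : List ℕ) (ω : Env) : coin (flip w ω) w = !coin ω w := by
  simp [coin, flip]

theorem coin_flip_of_ne {w u : List ℕ} (h : u ≠ w) (ω : Env) : coin (flip w ω) u = coin ω u := by
  simp [coin, flip, h]

theorem generation_flip (w : List ℕ) (ω : Env) (k : ℕ) :
    generation (flip w ω) k = generation ω k :=
  mem_generation_congr fun u _ => deg_flip w u ω

theorem map_not_uniform :
    ((PMF.uniformOfFintype Bool).toMeasure).map (fun b => !b) =
      (PMF.uniformOfFintype Bool).toMeasure := by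
  refine Measure.ext_of_singleton fun b => ?_
  rw [Measure.map_apply (measurable_of_countable _) (measurableSet_singleton b)]
  have h : (fun b : Bool => !b) ⁻¹' {b} = {!b} := by
    ext c; cases b <;> cases c <;> simp
  rw [h, PMF.toMeasure_apply_singleton _ _ (MeasurableSet.of_discrete),
    PMF.toMeasure_apply_singleton _ _ (MeasurableSet.of_discrete)]
  simp

variable {τ : ℝ} (L : DegreeLaw τ)

theorem measurePreserving_flip (w : List ℕ) :
    MeasurePreserving (flip w) L.envMeasure L.envMeasure := by
  classical
  let f : (u : List ℕ) → ℕ × Bool → ℕ × Bool := fun u x => if u = w then (x.1, !x.2) else x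
  have hf : ∀ u, Measurable (f u) := fun u => measurable_of_countable _
  have hmap : ∀ u, ((L.offspring u).toMeasure.prod (PMF.uniformOfFintype Bool).toMeasure).map (f u)
      = (L.offspring u).toMeasure.prod (PMF.uniformOfFintype Bool).toMeasure := by
    intro u
    by_cases h : u = w
    · have h1 : f u = Prod.map id (fun b => !b) := by
        ext x <;> simp [f, h]
      rw [h1, ← Measure.map_prod_map _ _ measurable_id (measurable_of_countable _),
        map_not_uniform, Measure.map_id]
    · have h1 : f u = id := by
        ext x <;> simp [f, h]
      rw [h1, Measure.map_id]
  have h : flip w = fun ω u => f u (ω u) := by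
    ext ω u <;> by_cases h : u = w <;> simp [flip, f, h]
  refine ⟨?_, ?_⟩
  · rw [h]
    exact measurable_pi_lambda _ fun u => (hf u).comp (measurable_pi_apply u)
  · rw [h]
    unfold envMeasure
    rw [Measure.infinitePi_map_pi _ hf]
    simp only [hmap]

/-- Flipping the coin of `w` preserves the measure and exchanges the two halves of `E`. Invariance
under the flip thus takes the place of an independence argument. -/
theorem real_inter_coin {E : Set Env} (mE : MeasurableSet E) (w : List ℕ)
    (hE : ∀ ω, ω ∈ E ↔ flip w ω ∈ E) :
    L.envMeasure.real (E ∩ {ω | coin ω w = true}) = L.envMeasure.real E / 2 := by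
  have h1 : flip w ⁻¹' (E ∩ {ω | coin ω w = true}) = E \ {ω | coin ω w = true} := by
    ext ω
    simp only [mem_preimage, mem_inter_iff, ← hE ω, mem_ofPred_eq, coin_flip_self, Set.mem_sdiff]
    simp
  have h2 := (L.measurePreserving_flip w).measureReal_preimage
    (mE.inter (measurableSet_coin w)).nullMeasurableSet
  rw [h1] at h2
  have h3 := measureReal_inter_add_sdiff (μ := L.envMeasure) (s := E) (measurableSet_coin w)
  linarith

theorem real_inter_coins {E : Set Env} (mE : MeasurableSet E) (W : Finset (List ℕ))
    (hE : ∀ w ∈ W, ∀ ω, ω ∈ E ↔ flip w ω ∈ E) :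
    L.envMeasure.real (E ∩ {ω | ∀ w ∈ W, coin ω w = true}) =
      L.envMeasure.real E / 2 ^ W.card := by
  classical
  induction W using Finset.induction_on generalizing E with
  | empty => simp
  | insert w W hw ih =>
    have h1 : E ∩ {ω | ∀ x ∈ insert w W, coin ω x = true} =
        (E ∩ {ω | coin ω w = true}) ∩ {ω | ∀ x ∈ W, coin ω x = true} := by
      ext ω
      simp [and_assoc]
    rw [h1, ih (mE.inter (measurableSet_coin w)), L.real_inter_coin mE w
      (hE w (Finset.mem_insert_self w W)), Finset.card_insert_of_notMem hw, pow_succ]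
    · field_simp
    · intro x hx ω
      have hne : w ≠ x := fun h => hw (h ▸ hx)
      simp only [mem_inter_iff, mem_ofPred_eq, coin_flip_of_ne hne,
        ← hE x (Finset.mem_insert_of_mem hx) ω]

section OpenPaths

variable {γ Q : ℝ}

theorem measurableSet_forall_not_openPath (u : List ℕ) (d r : ℕ) :
    MeasurableSet {ω : Env | ∀ i < d, ¬ OpenPath τ γ Q ω r (i :: u)} := by
  have h : {ω : Env | ∀ i < d, ¬ OpenPath τ γ Q ω r (i :: u)} =
      ⋂ i, ⋂ _ : i < d, {ω | OpenPath τ γ Q ω r (i :: u)}ᶜ := by ext; simp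
  rw [h]
  exact MeasurableSet.iInter fun i => MeasurableSet.iInter fun _ =>
    (measurableSet_openPath r (i :: u)).compl

/-- The subtrees of the children are disjoint from one another and from the generations that
determine `F`, so the probability factorises, with `1 - b ≤ exp (-b)` for each child. The number `d`
is deterministic; callers take it as a lower bound for the actual degree. -/
theorem real_inter_forall_not_openPath_le (u : List ℕ) (d r : ℕ) {b : ℝ}
    (hb : ∀ i, b ≤ L.envMeasure.real {ω | OpenPath τ γ Q ω r (i :: u)}) {F : Set Env}
    (mF : MeasurableSet F) (hF : DeterminedBy {w | w.length ≤ u.length} F) :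
    L.envMeasure.real (F ∩ {ω | ∀ i < d, ¬ OpenPath τ γ Q ω r (i :: u)}) ≤
      L.envMeasure.real F * Real.exp (-(b * d)) := by
  have h := L.real_inter_biInter (Finset.range d) {w | w.length ≤ u.length}
    (fun i => {w | i :: u <:+ w}) F (fun i => {ω | OpenPath τ γ Q ω r (i :: u)}ᶜ)
    (fun i _ => Set.disjoint_left.2 fun w h1 h2 => by
      have h3 := List.IsSuffix.length_le h2
      simp only [mem_ofPred_eq, List.length_cons] at h1 h3
      omega)
    (fun i _ j _ hij => Set.disjoint_left.2 fun w h1 h2 => hij (by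
      have h3 := List.IsSuffix.eq_of_length
        (List.suffix_of_suffix_length_le h1 h2 (by simp)) (by simp)
      exact (List.cons.inj h3).1))
    hF mF (fun i _ => (determinedBy_openPath r (i :: u)).compl)
    (fun i _ => (measurableSet_openPath r (i :: u)).compl)
  have e : {ω : Env | ∀ i < d, ¬ OpenPath τ γ Q ω r (i :: u)} =
      ⋂ i ∈ Finset.range d, {ω | OpenPath τ γ Q ω r (i :: u)}ᶜ := by ext; simp
  rw [e, h]
  refine mul_le_mul_of_nonneg_left ?_ measureReal_nonneg
  calc _ ≤ ∏ i ∈ Finset.range d, Real.exp (-b) := by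
        refine Finset.prod_le_prod (fun _ _ => measureReal_nonneg) fun i _ => ?_
        rw [probReal_compl_eq_one_sub (measurableSet_openPath r (i :: u))]
        linarith [hb i, Real.add_one_le_exp (-b)]
    _ = _ := by
        rw [Finset.prod_const, Finset.card_range, ← Real.exp_nat_mul]
        congr 1; ring

/-- Degrees of this size, `r` generations before the last one, yield an open path with
probability bounded away from zero. -/
def threshold (τ γ Q B : ℝ) (r : ℕ) : ℝ := B * Q ^ (γ * (τ - 2) ^ r)

theorem one_le_threshold {B : ℝ} (hB : 1 ≤ B) (hQ : 1 ≤ Q) (hγ : 0 ≤ γ) (hτ : 2 ≤ τ) (r : ℕ) :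
    1 ≤ threshold τ γ Q B r :=
  one_le_mul_of_one_le_of_one_le hB
    (Real.one_le_rpow hQ (mul_nonneg hγ (pow_nonneg (by linarith) r)))

/-- The balance behind `threshold`: the number of children at one level times the order of the
success probability at the next does not depend on `Q` or `r`, and is large when `B` is. -/
theorem threshold_rpow_mul {B : ℝ} (hB : 0 < B) (hQ : 0 < Q) (r : ℕ) :
    threshold τ γ Q B r ^ (-(τ - 2)) * threshold τ γ Q B (r + 1) = B ^ (1 - (τ - 2)) := by
  unfold threshold
  rw [Real.mul_rpow hB.le (by positivity), ← Real.rpow_mul hQ.le]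
  have e : γ * (τ - 2) ^ r * -(τ - 2) = -(γ * (τ - 2) ^ (r + 1)) := by ring
  rw [e, Real.rpow_neg hQ.le, show 1 - (τ - 2) = -(τ - 2) + 1 by ring, Real.rpow_add_one hB.ne']
  have : 0 < Q ^ (γ * (τ - 2) ^ (r + 1)) := by positivity
  field_simp

/-- Induction on `r` without loss in the constant. Of the factor `c`, one half is lost to the coin
of `u` and one half to the event, of conditional probability at most 1/2 by the choice of `B`, that
none of the first `⌈t⌉₊` children starts an open path. -/
theorem le_real_openPath {c C : ℝ} (hc : 0 < c) (hlow : ∀ x : ℝ, 1 ≤ x →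
      c * x ^ (-(τ - 2)) ≤ L.sizeBiased.toMeasure.real {k : ℕ | x ≤ (k : ℝ)})
    (hup : ∀ x : ℝ, 1 ≤ x →
      L.sizeBiased.toMeasure.real {k : ℕ | x ≤ (k : ℝ)} ≤ C * x ^ (-(τ - 2)))
    {B : ℝ} (hB : 1 ≤ B) (hBexp : Real.exp (-(c / 4 * B ^ (1 - (τ - 2)))) ≤ 1 / 2)
    (hγ : 0 < γ) (hQ : 1 ≤ Q) (hQC : C * Q⁻¹ ≤ c / 2 * Q ^ (-(γ * (τ - 2))))
    (r : ℕ) {u : List ℕ} (hu : u ≠ []) :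
    c / 4 * threshold τ γ Q B r ^ (-(τ - 2)) ≤ L.envMeasure.real {ω | OpenPath τ γ Q ω r u} := by
  have h2 := L.two_lt
  have hQ0 : 0 < Q := by linarith
  have hτ : τ - 2 ≠ 0 := by linarith
  induction r generalizing u with
  | zero =>
    have e : {ω : Env | OpenPath τ γ Q ω 0 u} = {ω | deg ω u ∈ {k : ℕ | Q ^ γ ≤ (k : ℝ)} \
        {k : ℕ | Q ^ (1 / (τ - 2)) ≤ (k : ℝ)} ∧ coin ω u = true} := by
      ext ω
      simp only [OpenPath, mem_ofPred_eq, Set.mem_sdiff, not_le]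
      tauto
    rw [e, real_deg_coin, offspring_of_ne_nil L hu]
    -- Degrees from `Q ^ (1/α)` on have probability at most `C / Q`, which `hQC` makes at most half
    -- of the lower bound for the tail at `Q ^ γ`.
    have h3 := le_measureReal_sdiff (μ := L.sizeBiased.toMeasure)
      (s₁ := {k : ℕ | Q ^ γ ≤ (k : ℝ)}) (s₂ := {k : ℕ | Q ^ (1 / (τ - 2)) ≤ (k : ℝ)})
    have h4 := hlow (Q ^ γ) (Real.one_le_rpow hQ hγ.le)
    have h5 := hup (Q ^ (1 / (τ - 2))) (Real.one_le_rpow hQ (one_div_nonneg.2 (by linarith)))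
    rw [← Real.rpow_mul hQ0.le, show γ * -(τ - 2) = -(γ * (τ - 2)) by ring] at h4
    rw [← Real.rpow_mul hQ0.le, show 1 / (τ - 2) * -(τ - 2) = -1 by field_simp,
      Real.rpow_neg_one] at h5
    have h6 : threshold τ γ Q B 0 ^ (-(τ - 2)) ≤ Q ^ (-(γ * (τ - 2))) := by
      unfold threshold
      rw [Real.mul_rpow (by linarith) (by positivity), ← Real.rpow_mul hQ0.le,
        show γ * (τ - 2) ^ 0 * -(τ - 2) = -(γ * (τ - 2)) by ring]
      refine mul_le_of_le_one_left (by positivity) ?_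
      exact Real.rpow_le_one_of_one_le_of_nonpos hB (by linarith)
    have h7 := mul_le_mul_of_nonneg_left h6 (by positivity : 0 ≤ c / 4)
    linarith
  | succ r ih =>
    set t := threshold τ γ Q B (r + 1) with ht
    have ht1 : 1 ≤ t := one_le_threshold hB hQ hγ.le h2.le _
    set F : Set Env := {ω | deg ω u ∈ {k : ℕ | t ≤ (k : ℝ)} ∧ coin ω u = true} with hF
    have mF : MeasurableSet F :=
      (measurableSet_deg u fun d => d ∈ {k : ℕ | t ≤ (k : ℝ)}).inter (measurableSet_coin u)
    have hFr : L.envMeasure.real F = L.sizeBiased.toMeasure.real {k : ℕ | t ≤ (k : ℝ)} / 2 := by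
      rw [hF, real_deg_coin, offspring_of_ne_nil L hu]
    have hno := L.real_inter_forall_not_openPath_le (γ := γ) (Q := Q) u ⌈t⌉₊ r
      (fun i => ih (u := i :: u) (by simp)) mF
      ((determinedBy_coord u fun x => x.1 ∈ {k : ℕ | t ≤ (k : ℝ)} ∧ x.2 = true).mono
        (by simp))
    have hsub : F \ (F ∩ {ω | ∀ i < ⌈t⌉₊, ¬ OpenPath τ γ Q ω r (i :: u)}) ⊆
        {ω | OpenPath τ γ Q ω (r + 1) u} := by
      rintro ω ⟨hω, h3⟩
      have h4 : ∃ i < ⌈t⌉₊, OpenPath τ γ Q ω r (i :: u) := by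
        by_contra h5
        push Not at h5
        exact h3 ⟨hω, h5⟩
      obtain ⟨i, hi, h5⟩ := h4
      exact ⟨hω.2, i, hi.trans_le (Nat.ceil_le.2 hω.1), h5⟩
    have h3 := measureReal_mono (μ := L.envMeasure) hsub
    rw [measureReal_sdiff inter_subset_left
      (mF.inter (measurableSet_forall_not_openPath u ⌈t⌉₊ r))] at h3
    have h4 : Real.exp (-(c / 4 * threshold τ γ Q B r ^ (-(τ - 2)) * ⌈t⌉₊)) ≤ 1 / 2 := by
      refine le_trans (Real.exp_le_exp.2 (neg_le_neg ?_)) hBexp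
      rw [← threshold_rpow_mul (τ := τ) (γ := γ) (by linarith : 0 < B) hQ0 r, ← mul_assoc]
      have h5 : 0 < threshold τ γ Q B r := by linarith [one_le_threshold hB hQ hγ.le h2.le r]
      refine mul_le_mul_of_nonneg_left (Nat.le_ceil t) (by positivity)
    have h5 := mul_le_mul_of_nonneg_left h4 (measureReal_nonneg (μ := L.envMeasure) (s := F))
    have h6 := hlow t ht1
    linarith

/-- With high probability, an individual of generation `k` with large degree has a child from
which an open path starts. -/
theorem real_large_no_openPath_le {b t : ℝ} (k r : ℕ) (hb0 : 0 ≤ b)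
    (hb : ∀ u : List ℕ, u ≠ [] → b ≤ L.envMeasure.real {ω | OpenPath τ γ Q ω r u}) :
    L.envMeasure.real ({ω | ∃ v ∈ generation ω k, t ≤ deg ω v} ∩
      {ω | ∀ v ∈ generation ω k, ∀ i < deg ω v, ¬ OpenPath τ γ Q ω r (i :: v)}) ≤
      Real.exp (-(b * t)) := by
  set E : List ℕ → Set Env := fun v => {ω | v ∈ generation ω k} ∩ {ω | t ≤ deg ω v} with hE
  have mE : ∀ v, MeasurableSet (E v) := fun v =>
    (measurableSet_mem_generation k v).inter (measurableSet_deg v fun d => t ≤ (d : ℝ))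
  have dE : ∀ v, DeterminedBy {w | w.length ≤ k} (E v) := by
    intro v ω ω' h
    simp only [hE, mem_inter_iff, mem_ofPred_eq]
    rw [mem_generation_congr (ω' := ω') fun u hu => by simp only [deg, h u (le_of_lt hu)]]
    refine and_congr_right fun hv => ?_
    have := h v (length_of_mem_generation hv).le
    simp only [deg, this]
  -- Splitting according to the first large individual keeps the conditioning event inside
  -- generations up to `k`, and makes the probabilities sum to at most 1.
  set G : List ℕ → Set Env := fun v =>
    firstOf E v ∩ {ω | ∀ i < ⌈t⌉₊, ¬ OpenPath τ γ Q ω r (i :: v)} with hG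
  have hGle : ∀ v, L.envMeasure.real (G v) ≤
      L.envMeasure.real (firstOf E v) * Real.exp (-(b * t)) := by
    intro v
    by_cases hv : v.length = k
    · refine (L.real_inter_forall_not_openPath_le v ⌈t⌉₊ r (fun i => hb (i :: v) (by simp))
        (measurableSet_firstOf mE v) ?_).trans ?_
      · rw [hv]
        exact fun ω ω' h => mem_firstOf_congr (fun v => dE v ω ω' h) v
      · gcongr
        exact Nat.le_ceil t
    · have : G v = ∅ := eq_empty_of_forall_notMem fun ω hω =>
        hv (length_of_mem_generation (firstOf_subset E v hω.1).1)
      rw [this]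
      simp only [measureReal_empty]
      exact mul_nonneg measureReal_nonneg (Real.exp_pos _).le
  have hsub : {ω | ∃ v ∈ generation ω k, t ≤ deg ω v} ∩
      {ω | ∀ v ∈ generation ω k, ∀ i < deg ω v, ¬ OpenPath τ γ Q ω r (i :: v)} ⊆ ⋃ v, G v := by
    rintro ω ⟨⟨v, hv, ht⟩, hno⟩
    obtain ⟨w, hw⟩ := mem_iUnion.1 (iUnion_subset_iUnion_firstOf E (mem_iUnion.2 ⟨v, hv, ht⟩))
    have hw' := firstOf_subset E w hw
    exact mem_iUnion.2 ⟨w, hw, fun i hi => hno w hw'.1 i (hi.trans_le (Nat.ceil_le.2 hw'.2))⟩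
  have hsum := hasSum_measureReal_firstOf L.envMeasure mE
  have hsumG : Summable fun v => L.envMeasure.real (G v) :=
    Summable.of_nonneg_of_le (fun _ => measureReal_nonneg) hGle (hsum.summable.mul_right _)
  have hfin : L.envMeasure.real (⋃ v, G v) ≤ ∑' v, L.envMeasure.real (G v) := by
    have h1 := measure_iUnion_le (μ := L.envMeasure) G
    have h2 : ∑' v, L.envMeasure (G v) = ENNReal.ofReal (∑' v, L.envMeasure.real (G v)) := by
      rw [ENNReal.ofReal_tsum_of_nonneg (fun _ => measureReal_nonneg) hsumG]
      exact tsum_congr fun v => (ENNReal.ofReal_toReal (measure_ne_top _ _)).symm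
    rw [h2] at h1
    exact ENNReal.toReal_le_of_le_ofReal (tsum_nonneg fun _ => measureReal_nonneg) h1
  calc _ ≤ _ := measureReal_mono hsub
    _ ≤ _ := hfin
    _ ≤ ∑' v, L.envMeasure.real (firstOf E v) * Real.exp (-(b * t)) :=
        hsumG.tsum_le_tsum hGle (hsum.summable.mul_right _)
    _ = L.envMeasure.real (⋃ v, E v) * Real.exp (-(b * t)) := by
        rw [tsum_mul_right, hsum.tsum_eq]
    _ ≤ 1 * Real.exp (-(b * t)) := by gcongr; exact measureReal_le_one
    _ = _ := one_mul _

theorem measurableSet_maxDeg_lt (n : ℕ) :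
    MeasurableSet {ω : Env | ∀ m < n, (maxDeg ω m : ℝ) < Q} := by
  have h : {ω : Env | ∀ m < n, (maxDeg ω m : ℝ) < Q} =
      ⋂ m, ⋂ _ : m < n, {ω | (maxDeg ω m : ℝ) < Q} := by ext; simp
  rw [h]
  exact MeasurableSet.iInter fun m => MeasurableSet.iInter fun _ =>
    measurable_maxDeg m (MeasurableSet.of_discrete (s := {d : ℕ | (d : ℝ) < Q}))

/-- Below generation `k` the open path is already given; only the coins of the `k + 1` individuals
from the root to `v` are still to be chosen. The event does not involve the coins of generations up
to `k`, so these show `true` at the price of `2 ^ (-(k+1))`. -/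
theorem le_probRootBlue (hQ : 1 ≤ Q) (hγ : 1 ≤ γ) (k r : ℕ) :
    L.envMeasure.real ({ω | ∀ m < k + (r + 1), (maxDeg ω m : ℝ) < Q} ∩
      {ω | ∃ v ∈ generation ω k, ∃ i < deg ω v, OpenPath τ γ Q ω r (i :: v)}) / 2 ^ (k + 1) ≤
      L.probRootBlue γ Q := by
  classical
  set F : Set Env := {ω | ∀ m < k + (r + 1), (maxDeg ω m : ℝ) < Q} with hF
  set E : List ℕ → Set Env := fun v => F ∩ ({ω | v ∈ generation ω k} ∩
    {ω | ∃ i < deg ω v, OpenPath τ γ Q ω r (i :: v)}) with hE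
  have mE : ∀ v, MeasurableSet (E v) := by
    intro v
    refine (measurableSet_maxDeg_lt _).inter ((measurableSet_mem_generation k v).inter ?_)
    have h : {ω : Env | ∃ i < deg ω v, OpenPath τ γ Q ω r (i :: v)} =
        ⋃ i, ({ω | i < deg ω v} ∩ {ω | OpenPath τ γ Q ω r (i :: v)}) := by ext; simp
    rw [h]
    exact MeasurableSet.iUnion fun i =>
      (measurableSet_deg v fun d => i < d).inter (measurableSet_openPath r (i :: v))
  have flipE : ∀ w : List ℕ, w.length ≤ k → ∀ v ω, ω ∈ E v ↔ flip w ω ∈ E v := by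
    intro w hw v ω
    have h1 : ∀ m, maxDeg (flip w ω) m = maxDeg ω m := fun m => by
      unfold maxDeg
      rw [generation_flip]
      exact Finset.sup_congr rfl fun u _ => deg_flip w u ω
    simp only [hE, hF, mem_inter_iff, mem_ofPred_eq, h1, generation_flip, deg_flip]
    refine and_congr_right fun _ => and_congr_right fun hv => ?_
    refine exists_congr fun i => and_congr_right fun _ => ?_
    refine determinedBy_openPath r (i :: v) ω (flip w ω) fun x hx => ?_
    have h2 := List.IsSuffix.length_le hx
    rw [List.length_cons, length_of_mem_generation hv] at h2
    have h3 : x ≠ w := by rintro rfl; omega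
    simp [flip, h3]
  set P : List ℕ → Set Env := fun v =>
    firstOf E v ∩ {ω | ∀ w ∈ v.tails.toFinset, coin ω w = true} with hP
  have mP : ∀ v, MeasurableSet (P v) := by
    intro v
    refine (measurableSet_firstOf mE v).inter ?_
    have h : {ω : Env | ∀ w ∈ v.tails.toFinset, coin ω w = true} =
        ⋂ w, ⋂ _ : w ∈ v.tails.toFinset, {ω | coin ω w = true} := by ext; simp
    rw [h]
    exact MeasurableSet.iInter fun w => MeasurableSet.iInter fun _ => measurableSet_coin w
  have hPr : ∀ v, L.envMeasure.real (firstOf E v) / 2 ^ (k + 1) ≤ L.envMeasure.real (P v) := by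
    intro v
    by_cases hv : v.length = k
    · rw [hP, L.real_inter_coins (measurableSet_firstOf mE v) v.tails.toFinset]
      · gcongr
        · norm_num
        · refine (List.toFinset_card_le _).trans ?_
          rw [List.length_tails, hv]
      · intro w hw ω
        rw [List.mem_toFinset, List.mem_tails] at hw
        exact mem_firstOf_congr (fun v => flipE w (hv ▸ hw.length_le) v ω) v
    · have : firstOf E v = ∅ := eq_empty_of_forall_notMem fun ω hω =>
        hv (length_of_mem_generation (firstOf_subset E v hω).2.1)
      rw [this]
      simp [measureReal_nonneg]
  have hsub : ⋃ v, P v ⊆ {ω | rootColour τ γ Q ω = Colour.blue} := by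
    intro ω hω
    obtain ⟨v, hv, hcoin⟩ := mem_iUnion.1 hω
    obtain ⟨hFω, hgen, i, hi, hop⟩ := firstOf_subset E v hv
    have hcoin' : ∀ w, w <:+ v → coin ω w = true := fun w hw =>
      hcoin w (List.mem_toFinset.2 ((List.mem_tails w v).2 hw))
    have hroot : OpenPath τ γ Q ω (k + (r + 1)) [] :=
      OpenPath.from_root hgen hcoin' ⟨hcoin' v List.suffix_rfl, i, hi, hop⟩
    -- The end of the path has degree at least `Q ^ γ ≥ Q`, and `F` excludes such degrees earlier.
    have hκ : stopGen ω Q = k + (r + 1) := by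
      obtain ⟨x, hx, hdeg⟩ := hroot.exists_deg (j := 0) ((mem_generation_zero ω []).2 rfl)
      rw [zero_add] at hx
      have hQγ : Q ≤ Q ^ γ := by
        calc Q = Q ^ (1 : ℝ) := (Real.rpow_one Q).symm
          _ ≤ Q ^ γ := Real.rpow_le_rpow_of_exponent_le hQ hγ
      refine le_antisymm (Nat.sInf_le ⟨x, hx, hQγ.trans hdeg⟩) ?_
      refine le_csInf ⟨_, x, hx, hQγ.trans hdeg⟩ ?_
      rintro m ⟨y, hy, hyQ⟩
      by_contra hm
      push Not at hm
      have h1 : (deg ω y : ℝ) ≤ maxDeg ω m := by exact_mod_cast deg_le_maxDeg hy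
      linarith [hFω m hm]
    change colour τ γ Q ω (stopGen ω Q) [] = _
    rw [hκ]
    exact hroot.colour_eq_blue
  have hdisj : Pairwise (Function.onFun Disjoint P) := fun v w hvw =>
    (pairwise_disjoint_firstOf E hvw).mono inter_subset_left inter_subset_left
  have hsum := hasSum_measureReal_firstOf L.envMeasure mE
  have hU : F ∩ {ω | ∃ v ∈ generation ω k, ∃ i < deg ω v, OpenPath τ γ Q ω r (i :: v)} =
      ⋃ v, E v := by
    ext ω
    simp [hE]
  rw [hU, ← hsum.tsum_eq, ← tsum_div_const]
  have h1 := measure_iUnion (μ := L.envMeasure) hdisj mP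
  have h2 : ∑' v, L.envMeasure (P v) ≠ ⊤ := h1 ▸ measure_ne_top _ _
  calc _ ≤ ∑' v, L.envMeasure.real (P v) :=
        (hsum.summable.div_const _).tsum_le_tsum hPr (ENNReal.summable_toReal h2)
    _ = L.envMeasure.real (⋃ v, P v) := by
        rw [Measure.real, h1, ENNReal.tsum_toReal_eq fun v => measure_ne_top _ _]
        rfl
    _ ≤ _ := measureReal_mono hsub

end OpenPaths

end DegreeLaw

/-! ### The lower bound, and the law of `log Y` on the circle. -/

namespace DegreeLaw

open BranchingTree

variable {τ : ℝ} (L : DegreeLaw τ)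

theorem exists_threshold_const {α c p : ℝ} (hα : α < 1) (hc : 0 < c) (hp : 0 < p) :
    ∃ B : ℝ, 1 ≤ B ∧ Real.exp (-(c * B ^ (1 - α))) ≤ p := by
  have h1 : Tendsto (fun B : ℝ => Real.exp (-(c * B ^ (1 - α)))) atTop (𝓝 0) :=
    Real.tendsto_exp_neg_atTop_nhds_zero.comp
      ((tendsto_rpow_atTop (by linarith)).const_mul_atTop hc)
  obtain ⟨B, h2, h3⟩ := ((h1.eventually (ge_mem_nhds hp)).and (eventually_ge_atTop 1)).exists
  exact ⟨B, h3, h2⟩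

theorem eventually_const_mul_inv_le {c C s : ℝ} (hc : 0 < c) (hs : s < 1) :
    ∀ᶠ Q : ℝ in atTop, C * Q⁻¹ ≤ c * Q ^ (-s) := by
  have h1 : Tendsto (fun Q : ℝ => c * Q ^ (1 - s)) atTop atTop :=
    (tendsto_rpow_atTop (by linarith)).const_mul_atTop hc
  filter_upwards [h1.eventually_ge_atTop C, eventually_gt_atTop 0] with Q h2 hQ
  rw [show -s = (1 - s) - 1 by ring, Real.rpow_sub_one hQ.ne', mul_div_assoc', ← div_eq_mul_inv]
  gcongr

/-- The generation `n` is chosen so that `log Q`, rescaled by `α ^ n`, falls into a compact interval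
independent of `Q`. -/
theorem exists_scale {α K ℓ : ℝ} (h0 : 0 < α) (h1 : α < 1) (hK : 0 < K) (hℓ : K ≤ ℓ) :
    ∃ n : ℕ, α * K ≤ α ^ n * ℓ ∧ α ^ n * ℓ ≤ K := by
  have hℓ0 : 0 < ℓ := by linarith
  obtain ⟨n, h2, h3⟩ := exists_nat_pow_near_of_lt_one (x := α * K / ℓ) (y := α) (by positivity)
    (by rw [div_le_one hℓ0]; nlinarith) h0 h1
  refine ⟨n, by rwa [div_le_iff₀ hℓ0] at h3, ?_⟩
  rw [lt_div_iff₀ hℓ0, pow_succ] at h2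
  nlinarith

theorem exists_lower_bound {Y : Env → ℝ} (mY : Measurable Y)
    (hlaw : L.lawY = L.envMeasure.map Y)
    (hlim : ∀ᵐ ω ∂L.envMeasure, Tendsto (fun n => scaledMaxDeg τ n ω) atTop (𝓝 (Y ω)))
    {K : ℝ} (hK : 0 < K) (hsupp : Ioo 0 K ⊆ L.lawY.support)
    {γ : ℝ} (hγ : 1 < γ) (hγτ : γ < 1 / (τ - 2)) :
    ∃ c : ℝ, 0 < c ∧ ∀ᶠ Q : ℝ in atTop, c ≤ L.probRootBlue γ Q := by
  have h2 := L.two_lt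
  have h3 := L.lt_three
  have hτ0 : 0 < τ - 2 := by linarith
  have hγα : γ * (τ - 2) < 1 := by rwa [lt_div_iff₀ hτ0] at hγτ
  obtain ⟨c, hc, hlow⟩ := L.sizeBiased_tail_lower
  obtain ⟨C, hC, hup⟩ := L.sizeBiased_tail_upper
  set α := τ - 2 with hα
  have hα1 : α < 1 := by linarith
  have hγα0 : 0 < γ * α := by positivity
  -- For `x ≥ α K` the midpoint of `[γ α x, x]` is at distance at least `4 δ` from both ends. At
  -- most three errors of size `δ` occur: `Y` against the midpoint, the maximal degree against `Y`,
  -- and the constant `B`.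
  obtain ⟨δ, hδ⟩ : ∃ δ : ℝ, δ = (1 - γ * α) * (α * K) / 8 := ⟨_, rfl⟩
  have hδ0 : 0 < δ := by
    have : 0 < 1 - γ * α := by linarith
    rw [hδ]; positivity
  have : IsProbabilityMeasure L.lawY := by
    rw [hlaw]; exact Measure.isProbabilityMeasure_map mY.aemeasurable
  -- Compactness makes `p` uniform over all positions of the midpoint, hence over `Q`. The interval
  -- lies inside `(0, K)` because `γ α < 1`.
  obtain ⟨p, hp, hball⟩ := exists_forall_le_measureReal_ball L.lawY
    (isCompact_Icc (a := (1 + γ * α) / 2 * (α * K)) (b := (1 + γ * α) / 2 * K)) hδ0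
    (fun x hx s hs => by
      refine Measure.mem_support_iff_forall x |>.1 (hsupp ⟨?_, ?_⟩) _ (Metric.ball_mem_nhds x hs)
      · exact lt_of_lt_of_le (by positivity) hx.1
      · exact lt_of_le_of_lt hx.2 (by nlinarith))
  have hp4 : 0 < min (1 / 2) (p / 4) := by positivity
  obtain ⟨B, hB, hBexp⟩ := exists_threshold_const (c := c / 4) hα1 (by positivity) hp4
  set A : ℕ → Set Env := fun n => {ω | |scaledMaxDeg τ n ω - Y ω| < δ} with hA
  have mA : ∀ n, MeasurableSet (A n) := fun n =>
    measurableSet_lt (((measurable_scaledMaxDeg n).sub mY).abs) measurable_const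
  have hAev : ∀ᵐ ω ∂L.envMeasure, ∀ᶠ n in atTop, ω ∈ A n := by
    filter_upwards [hlim] with ω hl
    exact Metric.tendsto_nhds.1 hl δ hδ0
  obtain ⟨N, hN⟩ := exists_measureReal_iUnion_compl_le L.envMeasure mA hAev
    (by positivity : 0 < p / 4)
  have hpow : Tendsto (fun k : ℕ => α ^ (k + 1) * Real.log B) atTop (𝓝 0) := by
    have := ((tendsto_pow_atTop_nhds_zero_of_lt_one hτ0.le hα1).comp
      (tendsto_add_atTop_nat 1)).mul_const (Real.log B)
    simpa using this
  -- `k` is fixed before `Q`, since it enters the final constant through `2 ^ (k + 1)`.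
  obtain ⟨k, hkB, hkN⟩ := ((hpow.eventually (gt_mem_nhds hδ0)).and (eventually_ge_atTop N)).exists
  have hN := hN k hkN
  refine ⟨p / 4 / 2 ^ (k + 1), by positivity, ?_⟩
  have hlogQ : ∀ᶠ Q : ℝ in atTop, (K + 1) / α ^ k ≤ Real.log Q :=
    Real.tendsto_log_atTop.eventually_ge_atTop _
  filter_upwards [eventually_const_mul_inv_le (C := C) (by positivity : 0 < c / 2) hγα, hlogQ,
    eventually_gt_atTop (1 : ℝ),
    L.exists_forall_measureReal_maxDeg_le k (by positivity : 0 < p / 4)] with Q hQC hQlog hQ1 hQM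
  have hQ0 : 0 < Q := by linarith
  rw [div_le_iff₀ (by positivity)] at hQlog
  set ℓ := Real.log Q with hℓ
  have hℓ0 : 0 < ℓ := Real.log_pos hQ1
  have hℓK : K ≤ ℓ := by nlinarith [pow_le_one₀ (n := k) hτ0.le hα1.le]
  obtain ⟨n, hn1, hn2⟩ := exists_scale hτ0 hα1 hK hℓK
  -- The `+ 1` in the lower bound for `log Q` gives `α ^ k * ℓ > K`, which rules out `n ≤ k`.
  have hkn : k < n := by
    by_contra h
    push Not at h
    have := pow_le_pow_of_le_one hτ0.le hα1.le h
    nlinarith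
  obtain ⟨r, rfl⟩ : ∃ r, n = k + (r + 1) := ⟨n - k - 1, by omega⟩
  set x := α ^ (k + (r + 1)) * ℓ with hx
  have hb : ∀ u : List ℕ, u ≠ [] → c / 4 * threshold τ γ Q B r ^ (-(τ - 2)) ≤
      L.envMeasure.real {ω | OpenPath τ γ Q ω r u} := fun u hu =>
    L.le_real_openPath hc hlow hup hB (hBexp.trans (min_le_left _ _)) (by linarith) hQ1.le hQC r hu
  have hlarge := L.real_large_no_openPath_le (t := threshold τ γ Q B (r + 1)) k r
    (mul_nonneg (by positivity)
      (Real.rpow_nonneg (by linarith [one_le_threshold hB hQ1.le (by linarith : 0 ≤ γ) h2.le r]) _))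
    hb
  rw [mul_assoc, threshold_rpow_mul (by linarith) hQ0] at hlarge
  have hlarge := hlarge.trans (hBexp.trans (min_le_right _ _))
  refine le_trans ?_ (L.le_probRootBlue hQ1.le hγ.le k r)
  gcongr
  set H : Set Env := {ω | ∀ m < k + (r + 1), (maxDeg ω m : ℝ) < Q} ∩
    {ω | ∃ v ∈ generation ω k, ∃ i < deg ω v, OpenPath τ γ Q ω r (i :: v)} with hH
  have hxK := hball ((1 + γ * α) / 2 * x)
    ⟨mul_le_mul_of_nonneg_left hn1 (by positivity), mul_le_mul_of_nonneg_left hn2 (by positivity)⟩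
  rw [hlaw, map_measureReal_apply mY Metric.isOpen_ball.measurableSet] at hxK
  -- The left side has probability at least `p`, and each of the three exceptional events on the
  -- right at most `p / 4`; this leaves `p / 4` for `H`. No independence between the two parts of
  -- `H` is needed.
  have hcover : Y ⁻¹' Metric.ball ((1 + γ * α) / 2 * x) δ ⊆
      H ∪ (({ω | ∃ v ∈ generation ω k, threshold τ γ Q B (r + 1) ≤ deg ω v} ∩
        {ω | ∀ v ∈ generation ω k, ∀ i < deg ω v, ¬ OpenPath τ γ Q ω r (i :: v)}) ∪
        ({ω | ∃ n ≥ k, ω ∉ A n} ∪ {ω | ∃ m ≤ k, Q ≤ (maxDeg ω m : ℝ)})) := by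
    intro ω hω
    by_contra hcon
    simp only [mem_union, not_or] at hcon
    obtain ⟨hnH, hnL, hgood, hsmall⟩ := hcon
    simp only [mem_ofPred_eq, not_exists, not_and, not_not, not_le] at hgood hsmall
    rw [mem_preimage, Metric.mem_ball, Real.dist_eq, abs_lt] at hω
    have hgap : 8 * δ ≤ (1 - γ * α) * x := by
      rw [hδ]
      have := mul_le_mul_of_nonneg_left hn1 (by linarith : 0 ≤ 1 - γ * α)
      linarith
    have hF : ω ∈ {ω : Env | ∀ m < k + (r + 1), (maxDeg ω m : ℝ) < Q} := by
      intro m hm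
      rcases le_total m k with h | h
      · exact hsmall m h
      · have h4 := abs_lt.1 (show |scaledMaxDeg τ m ω - Y ω| < δ from hgood m h)
        rcases Nat.eq_zero_or_pos (maxDeg ω m) with h5 | h5
        · rw [h5]; simpa using hQ0
        · have hpos : (0 : ℝ) < maxDeg ω m := by exact_mod_cast h5
          have h6 : scaledMaxDeg τ m ω < x := by nlinarith
          have h7 : x ≤ α ^ (m + 1) * ℓ :=
            mul_le_mul_of_nonneg_right
              (pow_le_pow_of_le_one hτ0.le hα1.le (by omega)) hℓ0.le
          have h8 : α ^ (m + 1) * Real.log (maxDeg ω m) < α ^ (m + 1) * ℓ := h6.trans_le h7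
          have h9 := lt_of_mul_lt_mul_left h8 (by positivity)
          exact (Real.log_lt_log_iff hpos hQ0).1 h9
    have hbig : threshold τ γ Q B (r + 1) ≤ maxDeg ω k := by
      have h4 := abs_lt.1 (show |scaledMaxDeg τ k ω - Y ω| < δ from hgood k le_rfl)
      have h5 : γ * α * x + α ^ (k + 1) * Real.log B ≤ scaledMaxDeg τ k ω := by nlinarith
      have h6 : γ * α * x = α ^ (k + 1) * (γ * α ^ (r + 1) * ℓ) := by rw [hx]; ring
      rw [h6, ← mul_add] at h5
      have h7 : γ * α ^ (r + 1) * ℓ + Real.log B ≤ Real.log (maxDeg ω k) :=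
        le_of_mul_le_mul_left h5 (by positivity)
      have hpos : (0 : ℝ) < maxDeg ω k := by
        rcases Nat.eq_zero_or_pos (maxDeg ω k) with h8 | h8
        · rw [h8] at h7
          have h9 : 0 ≤ Real.log B := Real.log_nonneg hB
          have h10 : 0 < γ * α ^ (r + 1) * ℓ := by positivity
          simp at h7
          linarith
        · exact_mod_cast h8
      have hB0 : 0 < B := by linarith
      rw [← Real.log_le_log_iff (by unfold threshold; positivity) hpos]
      unfold threshold
      rw [Real.log_mul hB0.ne' (by positivity), Real.log_rpow hQ0]
      linarith
    have hne : (generation ω k).Nonempty := by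
      rw [Finset.nonempty_iff_ne_empty]
      intro h4
      have h5 := one_le_threshold hB hQ1.le (by linarith : 0 ≤ γ) h2.le (r + 1)
      have h6 := h5.trans hbig
      simp [maxDeg, h4] at h6
      linarith
    obtain ⟨v, hv, hdeg⟩ := exists_deg_eq_maxDeg hne
    refine hnL ⟨⟨v, hv, by rw [hdeg]; exact hbig⟩, fun w hw i hi hop => ?_⟩
    exact hnH ⟨hF, w, hw, i, hi, hop⟩
  have hfin := (measureReal_mono (μ := L.envMeasure) hcover).trans
    ((measureReal_union_le _ _).trans (add_le_add le_rfl
      ((measureReal_union_le _ _).trans (add_le_add le_rfl (measureReal_union_le _ _)))))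
  linarith

theorem ae_pos {Y : Env → ℝ} (mY : Measurable Y) (hlaw : L.lawY = L.envMeasure.map Y)
    (hlim : ∀ᵐ ω ∂L.envMeasure, Tendsto (fun n => scaledMaxDeg τ n ω) atTop (𝓝 (Y ω)))
    (hac : L.lawY ≪ volume) : ∀ᵐ ω ∂L.envMeasure, 0 < Y ω := by
  have h2 := L.two_lt
  have h0 : L.envMeasure (Y ⁻¹' {0}) = 0 := by
    rw [← Measure.map_apply mY (measurableSet_singleton 0), ← hlaw]
    exact hac Real.volume_singleton
  filter_upwards [hlim, measure_eq_zero_iff_ae_notMem.1 h0] with ω hl hne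
  refine lt_of_le_of_ne (ge_of_tendsto' hl fun n => ?_) (fun h => hne h.symm)
  exact mul_nonneg (pow_nonneg (by linarith) _) (Real.log_natCast_nonneg _)

/-- Where `Y > 0`, the fibre over a point of the circle consists of countably many values of `Y`, a
Lebesgue null set. -/
theorem map_log_singleton {Y : Env → ℝ} (mY : Measurable Y)
    (hlaw : L.lawY = L.envMeasure.map Y) (hpos : ∀ᵐ ω ∂L.envMeasure, 0 < Y ω)
    (hac : L.lawY ≪ volume) (a : ℝ) (x : AddCircle a) :
    L.envMeasure.map (fun ω => (Real.log (Y ω) : AddCircle a)) {x} = 0 := by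
  have mV : Measurable fun ω => (Real.log (Y ω) : AddCircle a) :=
    (AddCircle.continuous_mk' a).measurable.comp (Real.measurable_log.comp mY)
  rw [Measure.map_apply mV (by
    rw [← Metric.closedBall_zero]; exact Metric.isClosed_closedBall.measurableSet)]
  obtain ⟨s, rfl⟩ := QuotientAddGroup.mk_surjective x
  have hcount : (range fun n : ℤ => Real.exp (s + n • a)).Countable := countable_range _
  have hnull : L.envMeasure (Y ⁻¹' range fun n : ℤ => Real.exp (s + n • a)) = 0 := by
    rw [← Measure.map_apply mY hcount.measurableSet, ← hlaw]
    exact hac (hcount.measure_zero _)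
  refine measure_mono_null ?_ (measure_union_null hnull (ae_iff.1 hpos))
  intro ω hω
  by_cases h : 0 < Y ω
  · left
    have h1 : (Real.log (Y ω) : AddCircle a) = (s : AddCircle a) := hω
    have h2 := QuotientAddGroup.eq.1 h1.symm
    obtain ⟨n, hn⟩ := h2
    refine ⟨n, ?_⟩
    change Real.exp (s + n • a) = Y ω
    have h3 : n • a = -s + Real.log (Y ω) := hn
    rw [h3, add_neg_cancel_left, Real.exp_log h]
  · exact Or.inr h

/-- Subtracting enough periods from a representative `t` gives `log y` with `0 < y < K`, and
neighbourhoods of such `y` are charged by the law of `Y`. -/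
theorem map_log_ball_pos {Y : Env → ℝ} (mY : Measurable Y)
    (hlaw : L.lawY = L.envMeasure.map Y) {K : ℝ} (hK : 0 < K)
    (hsupp : Ioo 0 K ⊆ L.lawY.support) {a : ℝ} (ha : 0 < a) (x : AddCircle a) {s : ℝ}
    (hs : 0 < s) :
    0 < L.envMeasure.map (fun ω => (Real.log (Y ω) : AddCircle a)) (Metric.ball x s) := by
  have mV : Measurable fun ω => (Real.log (Y ω) : AddCircle a) :=
    (AddCircle.continuous_mk' a).measurable.comp (Real.measurable_log.comp mY)
  rw [Measure.map_apply mV Metric.isOpen_ball.measurableSet]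
  obtain ⟨t, rfl⟩ := QuotientAddGroup.mk_surjective x
  obtain ⟨n, hn⟩ := exists_nat_gt ((t - Real.log K) / a)
  rw [div_lt_iff₀ ha] at hn
  set y := Real.exp (t - n * a) with hy
  have hy0 : 0 < y := Real.exp_pos _
  have hyK : y < K := by
    rw [hy, ← Real.lt_log_iff_exp_lt hK]; linarith
  have hcont : ContinuousAt Real.log y := Real.continuousAt_log hy0.ne'
  have hU : {z | dist (Real.log z) (Real.log y) < s} ∈ 𝓝 y :=
    hcont (Metric.ball_mem_nhds _ hs)
  have h1 := (Measure.mem_support_iff_forall y).1 (hsupp ⟨hy0, hyK⟩) _ hU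
  have mU : MeasurableSet {z : ℝ | dist (Real.log z) (Real.log y) < s} :=
    measurableSet_lt (Real.measurable_log.dist measurable_const) measurable_const
  rw [hlaw, Measure.map_apply mY mU] at h1
  refine h1.trans_le (measure_mono fun ω hω => ?_)
  have h2 : dist (Real.log (Y ω)) (Real.log y) < s := hω
  rw [mem_preimage, Metric.mem_ball]
  have e : ((t : ℝ) : AddCircle a) = (Real.log y : AddCircle a) := by
    rw [hy, Real.log_exp, AddCircle.coe_sub]
    have h3 : ((n * a : ℝ) : AddCircle a) = 0 :=
      (QuotientAddGroup.eq_zero_iff _).2 ⟨(n : ℤ), by simp⟩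
    rw [h3, sub_zero]
  change dist _ ((t : ℝ) : AddCircle a) < s
  rw [e, dist_eq_norm, ← AddCircle.coe_sub]
  rw [dist_eq_norm] at h2
  exact (QuotientAddGroup.norm_mk_le_norm (S := AddSubgroup.zmultiples a)).trans_lt h2

theorem probRootBlue_bounds (γ : ℝ) :
    IsBoundedUnder (· ≤ ·) atTop (fun Q : ℝ => L.probRootBlue γ Q) ∧
      IsBoundedUnder (· ≥ ·) atTop (fun Q : ℝ => L.probRootBlue γ Q) :=
  ⟨isBoundedUnder_of ⟨1, fun _ => measureReal_le_one⟩,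
    isBoundedUnder_of ⟨0, fun _ => measureReal_nonneg⟩⟩

end DegreeLaw

end

/-! ### Assembly of the two bounds. -/

theorem mainTheorem6 {τ : ℝ} (L : DegreeLaw τ)
    (hY_ac : L.lawY ≪ volume)
    (hY_supp : ∃ K : ℝ, 0 < K ∧ Set.Ioo 0 K ⊆ L.lawY.support) :
    ∃ c C : ℝ → ℝ,
      (∀ γ ∈ Set.Ioo 1 (1 / (τ - 2)),
        0 < c γ ∧ c γ ≤ C γ ∧ C γ < 1 ∧
        c γ ≤ liminf (fun Q : ℝ => L.probRootBlue γ Q) atTop ∧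
        liminf (fun Q : ℝ => L.probRootBlue γ Q) atTop
          ≤ limsup (fun Q : ℝ => L.probRootBlue γ Q) atTop ∧
        limsup (fun Q : ℝ => L.probRootBlue γ Q) atTop ≤ C γ) ∧
      AntitoneOn C (Set.Ioo 1 (1 / (τ - 2))) ∧
      Tendsto C (𝓝[<] (1 / (τ - 2))) (𝓝 0) := by
  obtain ⟨K, hK, hsupp⟩ := hY_supp
  obtain ⟨Y, mY, hlaw, hlim⟩ := L.exists_growth_limit
  have hpos := L.ae_pos mY hlaw hlim hY_ac
  have h2 := L.two_lt
  have h3 := L.lt_three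
  have hτ0 : 0 < τ - 2 := by linarith
  obtain ⟨a, ha⟩ : ∃ a : ℝ, a = -Real.log (τ - 2) := ⟨_, rfl⟩
  have ha0 : 0 < a := by rw [ha]; linarith [Real.log_neg hτ0 (by linarith)]
  have halog : Real.log (1 / (τ - 2)) = a := by rw [one_div, Real.log_inv, ha]
  have mV : Measurable fun ω => (Real.log (Y ω) : AddCircle a) :=
    (AddCircle.continuous_mk' a).measurable.comp (Real.measurable_log.comp mY)
  set ν := L.envMeasure.map fun ω => (Real.log (Y ω) : AddCircle a) with hν
  have : IsProbabilityMeasure ν := Measure.isProbabilityMeasure_map mV.aemeasurable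
  -- The geometric mean of `a` and `a - log γ` lies strictly between them. It exceeds the arc length
  -- `a - log γ`, leaving room for `δ > 0`; it is below the full circle, so that `C γ < 1`; and it
  -- decreases to 0 as `γ` increases to `1/α`.
  set C : ℝ → ℝ := fun γ => ballSup ν (√(a * (a - Real.log γ)) / 2) with hC
  have hloglt : ∀ γ ∈ Ioo 1 (1 / (τ - 2)), 0 < Real.log γ ∧ Real.log γ < a := fun γ hγ =>
    ⟨Real.log_pos hγ.1, halog ▸ Real.log_lt_log (by linarith [hγ.1]) hγ.2⟩
  have hsqrt : ∀ γ ∈ Ioo 1 (1 / (τ - 2)), a - Real.log γ < √(a * (a - Real.log γ)) ∧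
      √(a * (a - Real.log γ)) < a := by
    intro γ hγ
    obtain ⟨h4, h5⟩ := hloglt γ hγ
    exact ⟨Real.lt_sqrt_of_sq_lt (by nlinarith), (Real.sqrt_lt' ha0).2 (by nlinarith)⟩
  have hlower : ∀ γ, ∃ c : ℝ, γ ∈ Ioo 1 (1 / (τ - 2)) →
      0 < c ∧ ∀ᶠ Q : ℝ in atTop, c ≤ L.probRootBlue γ Q := by
    intro γ
    by_cases hγ : γ ∈ Ioo 1 (1 / (τ - 2))
    · obtain ⟨c, hc⟩ := L.exists_lower_bound mY hlaw hlim hK hsupp hγ.1 hγ.2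
      exact ⟨c, fun _ => hc⟩
    -- Outside the interval the value is irrelevant.
    · exact ⟨0, fun h => absurd h hγ⟩
  choose c hc using hlower
  refine ⟨c, C, fun γ hγ => ?_, ?_, ?_⟩
  · obtain ⟨hc0, hcQ⟩ := hc γ hγ
    obtain ⟨hbu, hbl⟩ := L.probRootBlue_bounds γ
    have hinf : c γ ≤ liminf (fun Q : ℝ => L.probRootBlue γ Q) atTop :=
      le_liminf_of_le hbu.isCoboundedUnder_ge hcQ
    have hmid : liminf (fun Q : ℝ => L.probRootBlue γ Q) atTop
        ≤ limsup (fun Q : ℝ => L.probRootBlue γ Q) atTop := liminf_le_limsup hbu hbl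
    have hsup : limsup (fun Q : ℝ => L.probRootBlue γ Q) atTop ≤ C γ := by
      refine le_of_forall_pos_le_add fun η hη => ?_
      refine limsup_le_of_le hbl.isCoboundedUnder_le ?_
      -- With this `δ` the radius `(a - log γ) / 2 + δ` is exactly the one in `C γ`.
      have h4 := L.probRootBlue_le mY hpos hlim hγ.1
        (δ := (√(a * (a - Real.log γ)) - (a - Real.log γ)) / 2) (by linarith [(hsqrt γ hγ).1]) hη
      rw [← ha] at h4
      filter_upwards [h4] with Q hQ
      refine hQ.trans_eq ?_
      rw [hC, hν]
      congr 2
      ring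
    have hlt : C γ < 1 := ballSup_lt_one ν ha0
      (fun x s hs => L.map_log_ball_pos mY hlaw hK hsupp ha0 x hs) (by linarith [(hsqrt γ hγ).2])
    exact ⟨hc0, hinf.trans (hmid.trans hsup), hlt, hinf, hmid, hsup⟩
  · intro γ hγ γ' hγ' hle
    refine ballSup_mono ν ?_
    have h4 := Real.log_le_log (by linarith [hγ.1]) hle
    gcongr
  · have h4 : Tendsto (fun γ : ℝ => √(a * (a - Real.log γ)) / 2) (𝓝 (1 / (τ - 2))) (𝓝 0) := by
      have h5 : ContinuousAt (fun γ : ℝ => √(a * (a - Real.log γ)) / 2) (1 / (τ - 2)) :=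
        ((Real.continuous_sqrt.continuousAt.comp (continuousAt_const.mul
          (continuousAt_const.sub (Real.continuousAt_log (by positivity))))).div_const 2)
      have h6 := h5.tendsto
      rwa [halog, sub_self, mul_zero, Real.sqrt_zero, zero_div] at h6
    exact ((tendsto_ballSup_zero ν ha0
      (L.map_log_singleton mY hlaw hpos hY_ac a)).comp h4).mono_left nhdsWithin_le_nhds
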